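/- Let $\mathbb E^4_1$ be $\mathbb R^4$ with the metric $dx_1^2+dx_2^2+dx_3^2-dx_4^2$, and let $a,b$ be nonzero real constants. Let $I\subseteq\mathbb R$ be an open interval and let $x,w:I\to\mathbb R$ be smooth functions with $x'^2-w'^2=-1$, such that $$M:\quad r(s,t)=(x(s)\cos at,\;x(s)\sin at,\;w(s)\sinh bt,\;w(s)\cosh bt),\qquad s\in I,\ t\in(0,2\pi),$$ is a timelike surface (its induced metric is Lorentzian at every point). Let $\nu=e_3\wedge e_4\in\Lambda^2\mathbb E^4_1$ be its Gauss map, where $e_3,e_4$ is an orthonormal frame of the normal plane such that $(\partial_s r,\partial_t r,e_3,e_4)$ is positively oriented, and let $\Delta=\sum_i\varepsilon_i(\nabla_{e_i}e_i-e_ie_i)$ be the Laplace operator of the induced metric, where $e_1,e_2$ is a local orthonormal tangent frame, $\varepsilon_i=\langle e_i,e_i\rangle$, and $\nabla$ is the Levi-Civita connection. $M$ is said to have pointwise 1-type Gauss map of the first kind if $\Delta\nu=f\nu$ for some smooth function $f$ on $M$ (for planes, $f=0$ is allowed). Then $M$ has pointwise 1-type Gauss map of the first kind if and only if $M$ is an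 open part of a timelike plane or, for some real $r_0\neq 0$, an open part of the surface $$F(s,t)=\Big(r_0\cosh\tfrac{s}{r_0}\cos at,\;r_0\cosh\tfrac{s}{r_0}\sin at,\;r_0\sinh\tfrac{s}{r_0}\sinh bt,\;r_0\sinh\tfrac{s}{r_0}\cosh bt\Big),\qquad s\in\mathbb R,\ t\in(0,2\pi).$$ Here a parametrized surface $r:U\to\mathbb E^4_1$ is an open part of a parametrized surface $F:V\to\mathbb E^4_1$ if $r=F\circ\varphi$ for a diffeomorphism $\varphi$ of $U$ onto an open subset of $V$; an open part of a plane means an open part of an affine parametrization of it. Moreover, for every $r_0\ne 0$ the Gauss map $\nu$ of the surface $F$ satisfies $\Delta\nu=f\nu$ with $$f=\|h\|^2=\frac{2}{r_0^2}\left(1-\frac{a^2b^2}{\big(a^2\cosh^2(\frac{s}{r_0})+b^2\sinh^2(\frac{s}{r_0})\big)^2}\right),$$ where $\|h\|^2=\sum_{i,j,r}\varepsilon_i\varepsilon_j\varepsilon_r(h^r_{ij})^2$ is the squared length of the second fundamental form in orthonormal frames (indices $i,j\in\{1,2\}$ tangent, $r\in\{3,4\}$ normal). -/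

import Mathlib

open scoped ContDiff

noncomputable section

namespace MinkowskiSurface

/-- The underlying vector space of Minkowski space `𝔼⁴₁`. -/
abbrev E41 : Type := Fin 4 → ℝ

/-- The metric `dx₁² + dx₂² + dx₃² - dx₄²`. -/
def mink (u v : E41) : ℝ := u 0 * v 0 + u 1 * v 1 + u 2 * v 2 - u 3 * v 3

/-- Exterior product `u ∧ v` in `Λ² 𝔼⁴₁`. -/
def wedge (u v : E41) : ⋀[ℝ]^2 E41 := exteriorPower.ιMulti ℝ 2 ![u, v]

/-- Partial derivative with respect to the `i`-th parameter (`0` for `s`, `1` for `t`). -/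
def pd {V : Type*} [NormedAddCommGroup V] [NormedSpace ℝ V]
    (i : Fin 2) (φ : ℝ × ℝ → V) (p : ℝ × ℝ) : V :=
  if i = 0 then deriv (fun s => φ (s, p.2)) p.1 else deriv (fun t => φ (p.1, t)) p.2

/-- The matrix `(g i j)` of the induced metric of a parametrized surface. -/
def firstForm (r : ℝ × ℝ → E41) (p : ℝ × ℝ) : Matrix (Fin 2) (Fin 2) ℝ :=
  Matrix.of fun i j => mink (pd i r p) (pd j r p)

/-- The induced metric is Lorentzian at every point of `U`. -/
def IsTimelikeOn (r : ℝ × ℝ → E41) (U : Set (ℝ × ℝ)) : Prop :=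
  ∀ p ∈ U, (firstForm r p).det < 0

/-- The Laplace operator of the induced metric with the sign convention
`Δ = ∑ εᵢ (∇_{eᵢ} eᵢ - eᵢ eᵢ)`, that is, `Δ φ = - div (grad φ)`, in the parameters of the
surface. -/
def laplacian (r : ℝ × ℝ → E41) (φ : ℝ × ℝ → ℝ) (p : ℝ × ℝ) : ℝ :=
  -(1 / Real.sqrt |(firstForm r p).det|) *
    ∑ i, pd i (fun q => Real.sqrt |(firstForm r q).det| *
      ∑ j, (firstForm r q)⁻¹ i j * pd j φ q) p

/-- The second fundamental form `h(∂ᵢ, ∂ⱼ)`: the component of `∂ᵢ ∂ⱼ r` normal to the surface. -/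
def secondForm (r : ℝ × ℝ → E41) (i j : Fin 2) (p : ℝ × ℝ) : E41 :=
  pd i (pd j r) p -
    ∑ k, ∑ l, ((firstForm r p)⁻¹ k l * mink (pd i (pd j r) p) (pd k r p)) • pd l r p

/-- The squared length `‖h‖²` of the second fundamental form, all indices contracted with the
induced metric; in orthonormal frames it is `∑ εᵢ εⱼ εᵣ (hʳᵢⱼ)²`. -/
def sqLength (r : ℝ × ℝ → E41) (p : ℝ × ℝ) : ℝ :=
  ∑ i, ∑ j, ∑ k, ∑ l, (firstForm r p)⁻¹ i k * (firstForm r p)⁻¹ j l *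
    mink (secondForm r i j p) (secondForm r k l p)

/-- `ν` is the Gauss map on `U` of the timelike surface `r`, oriented by its parameters `(s, t)`:
`ν = e₃ ∧ e₄` for any orthonormal basis `e₃, e₄` of the normal plane for which
`∂ₛ r, ∂ₜ r, e₃, e₄` is positively oriented. -/
def IsGaussMap (r : ℝ × ℝ → E41) (U : Set (ℝ × ℝ)) (ν : ℝ × ℝ → ⋀[ℝ]^2 E41) : Prop :=
  ∀ p ∈ U, ∃ e₃ e₄ : E41,
    mink e₃ e₃ = 1 ∧ mink e₄ e₄ = 1 ∧ mink e₃ e₄ = 0 ∧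
    (∀ i, mink (pd i r p) e₃ = 0 ∧ mink (pd i r p) e₄ = 0) ∧
    0 < (Matrix.of ![pd 0 r p, pd 1 r p, e₃, e₄]).det ∧
    ν p = wedge e₃ e₄

/-- The equation `Δ ν = f (ν + C)` on `U`. The Laplace operator acts on the components of the
`Λ² 𝔼⁴₁`-valued map `ν`, so the equation is tested with every linear functional. -/
def GaussMapEq (r : ℝ × ℝ → E41) (U : Set (ℝ × ℝ)) (ν : ℝ × ℝ → ⋀[ℝ]^2 E41)
    (f : ℝ × ℝ → ℝ) (C : ⋀[ℝ]^2 E41) : Prop :=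
  ∀ p ∈ U, ∀ ℓ : (⋀[ℝ]^2 E41) →ₗ[ℝ] ℝ,
    laplacian r (fun q => ℓ (ν q)) p = ℓ (f p • (ν p + C))

/-- The surface has pointwise 1-type Gauss map of the first kind: `Δ ν = f ν` for some smooth
function `f` on the surface. -/
def HasPointwiseOneTypeFirstKind (r : ℝ × ℝ → E41) (U : Set (ℝ × ℝ)) : Prop :=
  ∃ (ν : ℝ × ℝ → ⋀[ℝ]^2 E41) (f : ℝ × ℝ → ℝ),
    IsGaussMap r U ν ∧ ContDiffOn ℝ ∞ f U ∧ GaussMapEq r U ν f 0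

/-- The surface `r : U → 𝔼⁴₁` is an open part of the surface `F : V → 𝔼⁴₁`: up to a
diffeomorphism `φ` of `U` onto an open subset of `V` (with inverse `ψ`), `r` is the restriction
of `F`. -/
def IsOpenPart (r : ℝ × ℝ → E41) (U : Set (ℝ × ℝ)) (F : ℝ × ℝ → E41) (V : Set (ℝ × ℝ)) :
    Prop :=
  ∃ φ ψ : ℝ × ℝ → ℝ × ℝ, IsOpen (φ '' U) ∧ φ '' U ⊆ V ∧
    ContDiffOn ℝ ∞ φ U ∧ ContDiffOn ℝ ∞ ψ (φ '' U) ∧ (∀ p ∈ U, ψ (φ p) = p) ∧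
    ∀ p ∈ U, r p = F (φ p)

/-- The affine map `(u, v) ↦ c + u X + v Y`. -/
def planeMap (c X Y : E41) (p : ℝ × ℝ) : E41 := c + p.1 • X + p.2 • Y

/-- The surface is an open part of some timelike (affine) plane, that is, of a plane through a
point `c` with a direction space spanned by orthonormal vectors `X` (timelike) and `Y`
(spacelike). -/
def IsOpenPartOfTimelikePlane (r : ℝ × ℝ → E41) (U : Set (ℝ × ℝ)) : Prop :=
  ∃ c X Y : E41, mink X X = -1 ∧ mink Y Y = 1 ∧ mink X Y = 0 ∧
    IsOpenPart r U (planeMap c X Y) Set.univ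

/-- `r(s, t) = (x(s) cos at, x(s) sin at, w(s) sinh bt, w(s) cosh bt)`. -/
def doubleRotational (a b : ℝ) (x w : ℝ → ℝ) (p : ℝ × ℝ) : E41 :=
  ![x p.1 * Real.cos (a * p.2), x p.1 * Real.sin (a * p.2),
    w p.1 * Real.sinh (b * p.2), w p.1 * Real.cosh (b * p.2)]

/-- The parameter domain `s ∈ I`, `t ∈ (0, 2π)`. -/
def paramDomain (I : Set ℝ) : Set (ℝ × ℝ) := I ×ˢ Set.Ioo 0 (2 * Real.pi)

/-- The surface with profile curve `x = r₀ cosh (s / r₀)`, `w = r₀ sinh (s / r₀)`. -/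
def surfaceF (a b r₀ : ℝ) : ℝ × ℝ → E41 :=
  doubleRotational a b (fun s => r₀ * Real.cosh (s / r₀)) (fun s => r₀ * Real.sinh (s / r₀))

end MinkowskiSurface

end

namespace MinkowskiSurface

open Filter Topology

/-! ### The exterior product -/

/-! The surface is swept out by a one-parameter isometry group, so it carries an invariant
orthonormal frame S, T, N₃, N₄ whose structure equations have coefficients depending on `s` alone: κ
(`curvProfile`), μ (`curvOrbit`), ω (`torsionCoeff`), η (`normalCoeff`) and λ (`tangentCoeff`).
Differentiating ν = N₃ ∧ N₄ twice and using the Codazzi equation for μ gives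
(`laplacian_adaptedGaussMap`) Δν = (κ² + μ² - 2ω²) ν + (κ' - μ') S ∧ N₄ - 2ω(κ + μ) S ∧ T + (μ - κ)η
N₃ ∧ T. The first coefficient is ‖h‖². Since the four bivectors are independent, Δν = fν means that
the other three coefficients vanish: the mean curvature vector (μ - κ)N₃/2 is parallel and the
normal bundle is flat.

The classification integrates these equations. The difference c = μ - κ is constant. If c = 0, then
ωκ = 0, and the Codazzi equation for ω forces κ = 0 (`curvProfile_eq_zero_of_torsion_mul`). Then μ =
0 too, the profile is x = 0, w = ±s + δ (`exists_affine_of_curv_eq_zero`), and the surface lies in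
the x₃x₄-plane. If c ≠ 0, then η = 0, so x² - w² is constant. Unit speed turns this into x = ρw', w
= ρx' (`exists_eq_mul_deriv_of_hyperbola`), whose solutions are cosh and sinh up to a sign and a
shift of `s` (`isOpenPart_of_hyperbola`).

Conversely, in a timelike plane κ = μ = ω = 0 (`coeffs_eq_zero_of_isOpenPartOfTimelikePlane`). On a
hyperbola κ = 1/ρ, μ = -1/ρ and η = 0. In both cases the three equations hold. -/

lemma wedge_add_left (u u' v : E41) : wedge (u + u') v = wedge u v + wedge u' v :=
  (exteriorPower.ιMulti ℝ 2 (M := E41)).map_vecCons_add ![v] u u'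

lemma wedge_smul_left (c : ℝ) (u v : E41) : wedge (c • u) v = c • wedge u v :=
  (exteriorPower.ιMulti ℝ 2 (M := E41)).map_vecCons_smul ![v] c u

lemma wedge_comm (u v : E41) : wedge u v = -wedge v u := by
  have h := (exteriorPower.ιMulti ℝ 2 (M := E41)).map_swap ![v, u] (i := 0) (j := 1) (by decide)
  refine Eq.trans ?_ h
  refine congrArg _ (funext fun i => ?_)
  fin_cases i <;> rfl

lemma wedge_self (u : E41) : wedge u u = 0 :=
  (exteriorPower.ιMulti ℝ 2 (M := E41)).map_eq_zero_of_eq ![u, u] (i := 0) (j := 1) rfl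
    (by decide)

lemma wedge_add_right (u v v' : E41) : wedge u (v + v') = wedge u v + wedge u v' := by
  rw [wedge_comm, wedge_add_left, wedge_comm u v, wedge_comm u v', neg_add]

lemma wedge_smul_right (c : ℝ) (u v : E41) : wedge u (c • v) = c • wedge u v := by
  rw [wedge_comm, wedge_smul_left, wedge_comm u v, smul_neg]

/-- The bilinear form `(u, v) ↦ ℓ (u ∧ v)`. -/
noncomputable def wedgeForm (ℓ : (⋀[ℝ]^2 E41) →ₗ[ℝ] ℝ) : E41 →ₗ[ℝ] E41 →ₗ[ℝ] ℝ :=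
  LinearMap.mk₂ ℝ (fun u v => ℓ (wedge u v))
    (fun u u' v => by rw [wedge_add_left, map_add])
    (fun c u v => by rw [wedge_smul_left, map_smul])
    (fun u v v' => by rw [wedge_add_right, map_add])
    (fun c u v => by rw [wedge_smul_right, map_smul])

/-- The product rule for a bilinear form, which is continuous in finite dimension. Testing with
functionals avoids any topology on the exterior square. -/
lemma hasDerivAt_wedge (ℓ : (⋀[ℝ]^2 E41) →ₗ[ℝ] ℝ) {u v : ℝ → E41} {u' v' : E41} {τ : ℝ}
    (hu : HasDerivAt u u' τ) (hv : HasDerivAt v v' τ) :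
    HasDerivAt (fun σ => ℓ (wedge (u σ) (v σ))) (ℓ (wedge u' (v τ)) + ℓ (wedge (u τ) v')) τ :=
  (((wedgeForm ℓ).toContinuousBilinearMap.hasFDerivAt.comp_hasDerivAt τ hu).clm_apply hv)

/-- The functional on `Λ² 𝔼⁴₁` with `u ∧ v ↦ ⟨u, X⟩ ⟨v, Y⟩ - ⟨u, Y⟩ ⟨v, X⟩`. -/
lemma exists_functional_wedge (X Y : E41) : ∃ ℓ : (⋀[ℝ]^2 E41) →ₗ[ℝ] ℝ, ∀ u v,
    ℓ (wedge u v) = mink u X * mink v Y - mink u Y * mink v X := by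
  let A : E41 →ₗ[ℝ] (Fin 2 → ℝ) := LinearMap.pi ![
    { toFun := fun u => mink u X
      map_add' := fun u v => by simp only [mink, Pi.add_apply]; ring
      map_smul' := fun c u => by
        simp only [mink, Pi.smul_apply, smul_eq_mul, RingHom.id_apply]; ring },
    { toFun := fun u => mink u Y
      map_add' := fun u v => by simp only [mink, Pi.add_apply]; ring
      map_smul' := fun c u => by
        simp only [mink, Pi.smul_apply, smul_eq_mul, RingHom.id_apply]; ring }]
  refine ⟨exteriorPower.alternatingMapLinearEquiv (Matrix.detRowAlternating.compLinearMap A),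
    fun u v => ?_⟩
  rw [wedge, exteriorPower.alternatingMapLinearEquiv_apply_ιMulti]
  exact Matrix.det_fin_two (Matrix.of fun i => A (![u, v] i))

/-! ### Vectors in rotating coordinates -/

/-- The vector with coordinates `p, q, m, n` in the frame `(cos at, sin at, 0, 0)`,
`(-sin at, cos at, 0, 0)`, `(0, 0, cosh bt, sinh bt)`, `(0, 0, sinh bt, cosh bt)`. -/
noncomputable def rotVec (a b t p q m n : ℝ) : E41 :=
  ![p * Real.cos (a * t) - q * Real.sin (a * t), p * Real.sin (a * t) + q * Real.cos (a * t),
    m * Real.cosh (b * t) + n * Real.sinh (b * t), m * Real.sinh (b * t) + n * Real.cosh (b * t)]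

lemma rotVec_add (a b t p q m n p' q' m' n' : ℝ) :
    rotVec a b t p q m n + rotVec a b t p' q' m' n' =
      rotVec a b t (p + p') (q + q') (m + m') (n + n') := by
  ext i
  fin_cases i <;> simp [rotVec] <;> ring

lemma smul_rotVec (a b t c p q m n : ℝ) :
    c • rotVec a b t p q m n = rotVec a b t (c * p) (c * q) (c * m) (c * n) := by
  ext i
  fin_cases i <;> simp [rotVec] <;> ring

lemma mink_rotVec (a b t p q m n p' q' m' n' : ℝ) :
    mink (rotVec a b t p q m n) (rotVec a b t p' q' m' n') =
      p * p' + q * q' + m * m' - n * n' := by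
  have h1 := Real.cos_sq_add_sin_sq (a * t)
  have h2 := Real.cosh_sq_sub_sinh_sq (b * t)
  simp only [mink, rotVec, Matrix.cons_val]
  linear_combination (p * p' + q * q') * h1 + (m * m' - n * n') * h2

lemma exists_eq_rotVec (a b t : ℝ) (v : E41) : ∃ p q m n, v = rotVec a b t p q m n := by
  have h1 := Real.cos_sq_add_sin_sq (a * t)
  have h2 := Real.cosh_sq_sub_sinh_sq (b * t)
  refine ⟨v 0 * Real.cos (a * t) + v 1 * Real.sin (a * t),
    -v 0 * Real.sin (a * t) + v 1 * Real.cos (a * t),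
    v 2 * Real.cosh (b * t) - v 3 * Real.sinh (b * t),
    -v 2 * Real.sinh (b * t) + v 3 * Real.cosh (b * t), ?_⟩
  ext i
  fin_cases i <;> simp only [rotVec, Matrix.cons_val, Fin.zero_eta, Fin.mk_one, Fin.reduceFinMk]
  · linear_combination -v 0 * h1
  · linear_combination -v 1 * h1
  · linear_combination -v 2 * h2
  · linear_combination -v 3 * h2

/-- The matrix of the moving frame is a rotation block and a boost block, so its determinant is 1
and orientation can be read off from the coordinates. -/
lemma det_rotVec (a b t p₀ q₀ m₀ n₀ p₁ q₁ m₁ n₁ p₂ q₂ m₂ n₂ p₃ q₃ m₃ n₃ : ℝ) :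
    (Matrix.of ![rotVec a b t p₀ q₀ m₀ n₀, rotVec a b t p₁ q₁ m₁ n₁, rotVec a b t p₂ q₂ m₂ n₂,
      rotVec a b t p₃ q₃ m₃ n₃]).det =
    (!![p₀, q₀, m₀, n₀; p₁, q₁, m₁, n₁; p₂, q₂, m₂, n₂; p₃, q₃, m₃, n₃] :
      Matrix (Fin 4) (Fin 4) ℝ).det := by
  have h1 := Real.cos_sq_add_sin_sq (a * t)
  have h2 := Real.cosh_sq_sub_sinh_sq (b * t)
  have key : (Matrix.of ![rotVec a b t p₀ q₀ m₀ n₀, rotVec a b t p₁ q₁ m₁ n₁,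
      rotVec a b t p₂ q₂ m₂ n₂, rotVec a b t p₃ q₃ m₃ n₃]) =
    (!![p₀, q₀, m₀, n₀; p₁, q₁, m₁, n₁; p₂, q₂, m₂, n₂; p₃, q₃, m₃, n₃] :
      Matrix (Fin 4) (Fin 4) ℝ) *
    !![Real.cos (a * t), Real.sin (a * t), 0, 0; -Real.sin (a * t), Real.cos (a * t), 0, 0;
      0, 0, Real.cosh (b * t), Real.sinh (b * t); 0, 0, Real.sinh (b * t), Real.cosh (b * t)] := by
    ext i j
    fin_cases i <;> fin_cases j <;>
      simp [rotVec, Matrix.mul_apply, Fin.sum_univ_succ] <;> ring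
  have hdet : (!![Real.cos (a * t), Real.sin (a * t), 0, 0;
      -Real.sin (a * t), Real.cos (a * t), 0, 0;
      0, 0, Real.cosh (b * t), Real.sinh (b * t);
      0, 0, Real.sinh (b * t), Real.cosh (b * t)] : Matrix (Fin 4) (Fin 4) ℝ).det = 1 := by
    simp [Matrix.det_succ_row_zero, Fin.sum_univ_succ, Fin.succAbove]
    linear_combination (Real.cosh (b * t) ^ 2 - Real.sinh (b * t) ^ 2) * h1 + h2
  rw [key, Matrix.det_mul, hdet, mul_one]

lemma hasDerivAt_rotVec_coeff (a b t : ℝ) {p q m n : ℝ → ℝ} {p' q' m' n' s : ℝ}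
    (hp : HasDerivAt p p' s) (hq : HasDerivAt q q' s) (hm : HasDerivAt m m' s)
    (hn : HasDerivAt n n' s) :
    HasDerivAt (fun s => rotVec a b t (p s) (q s) (m s) (n s)) (rotVec a b t p' q' m' n') s := by
  refine hasDerivAt_pi.2 fun i => ?_
  fin_cases i
  · exact (hp.mul_const _).sub (hq.mul_const _)
  · exact (hp.mul_const _).add (hq.mul_const _)
  · exact (hm.mul_const _).add (hn.mul_const _)
  · exact (hm.mul_const _).add (hn.mul_const _)

/-- The infinitesimal generator of the group acts on rotating coordinates by a constant matrix. All
`t`-derivatives below come from this. -/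
lemma hasDerivAt_rotVec_angle (a b t p q m n : ℝ) :
    HasDerivAt (fun t => rotVec a b t p q m n)
      (rotVec a b t (-a * q) (a * p) (b * n) (b * m)) t := by
  have ha : HasDerivAt (fun t => a * t) a t := by simpa using (hasDerivAt_id t).const_mul a
  have hb : HasDerivAt (fun t => b * t) b t := by simpa using (hasDerivAt_id t).const_mul b
  refine hasDerivAt_pi.2 fun i => ?_
  fin_cases i <;> simp only [rotVec, Matrix.cons_val, Fin.zero_eta, Fin.mk_one, Fin.reduceFinMk]
  · exact ((ha.cos.const_mul p).sub (ha.sin.const_mul q)).congr_deriv (by ring)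
  · exact ((ha.sin.const_mul p).add (ha.cos.const_mul q)).congr_deriv (by ring)
  · exact ((hb.cosh.const_mul m).add (hb.sinh.const_mul n)).congr_deriv (by ring)
  · exact ((hb.sinh.const_mul m).add (hb.cosh.const_mul n)).congr_deriv (by ring)

lemma doubleRotational_eq (a b : ℝ) (x w : ℝ → ℝ) (p : ℝ × ℝ) :
    doubleRotational a b x w p = rotVec a b p.2 (x p.1) 0 0 (w p.1) := by
  simp [doubleRotational, rotVec]

/-! ### The profile curve and the adapted frame -/

/-- A smooth profile curve `(x, w)` of unit timelike speed on the open set `I` whose double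
rotational surface is timelike. -/
structure IsProfile (a b : ℝ) (I : Set ℝ) (x w : ℝ → ℝ) : Prop where
  isOpen : IsOpen I
  contDiffOn_x : ContDiffOn ℝ ∞ x I
  contDiffOn_w : ContDiffOn ℝ ∞ w I
  unit : ∀ s ∈ I, deriv x s ^ 2 - deriv w s ^ 2 = -1
  pos : ∀ s ∈ I, 0 < a ^ 2 * x s ^ 2 + b ^ 2 * w s ^ 2

section Coefficients

variable (a b : ℝ) (x w : ℝ → ℝ) (s : ℝ)

/-- The length of `∂ₜ r`. -/
noncomputable def speed : ℝ := Real.sqrt (a ^ 2 * x s ^ 2 + b ^ 2 * w s ^ 2)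

/-- The curvature `κ` of the profile curve. -/
noncomputable def curvProfile : ℝ :=
  deriv (deriv x) s * deriv w s - deriv (deriv w) s * deriv x s

/-- The normal curvature `μ` in the direction of `∂ₜ r`. -/
noncomputable def curvOrbit : ℝ :=
  -(a ^ 2 * x s * deriv w s + b ^ 2 * w s * deriv x s) / (a ^ 2 * x s ^ 2 + b ^ 2 * w s ^ 2)

/-- The mixed coefficient `ω` of the second fundamental form. -/
noncomputable def torsionCoeff : ℝ :=
  a * b * (x s * deriv w s - w s * deriv x s) / (a ^ 2 * x s ^ 2 + b ^ 2 * w s ^ 2)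

/-- The coefficient `η` of the normal connection. -/
noncomputable def normalCoeff : ℝ :=
  a * b * (x s * deriv x s - w s * deriv w s) / (a ^ 2 * x s ^ 2 + b ^ 2 * w s ^ 2)

/-- The logarithmic derivative of `speed`. -/
noncomputable def tangentCoeff : ℝ :=
  (a ^ 2 * x s * deriv x s + b ^ 2 * w s * deriv w s) / (a ^ 2 * x s ^ 2 + b ^ 2 * w s ^ 2)

variable (t : ℝ)

/-- The unit timelike tangent vector `∂ₛ r`. -/
noncomputable def frameS : E41 := rotVec a b t (deriv x s) 0 0 (deriv w s)

/-- The unit spacelike tangent vector in the direction of `∂ₜ r`. -/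
noncomputable def frameT : E41 :=
  rotVec a b t 0 (a * x s / speed a b x w s) (b * w s / speed a b x w s) 0

/-- The first unit normal vector. -/
noncomputable def frameN₃ : E41 := rotVec a b t (deriv w s) 0 0 (deriv x s)

/-- The second unit normal vector. -/
noncomputable def frameN₄ : E41 :=
  rotVec a b t 0 (-(b * w s) / speed a b x w s) (a * x s / speed a b x w s) 0

end Coefficients

namespace IsProfile

variable {a b : ℝ} {I : Set ℝ} {x w : ℝ → ℝ} (h : IsProfile a b I x w) {s : ℝ} (hs : s ∈ I)

include h hs

lemma speed_pos : 0 < speed a b x w s := Real.sqrt_pos.2 (h.pos s hs)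

lemma speed_sq : speed a b x w s ^ 2 = a ^ 2 * x s ^ 2 + b ^ 2 * w s ^ 2 :=
  Real.sq_sqrt (h.pos s hs).le

lemma mem_nhds : I ∈ 𝓝 s := h.isOpen.mem_nhds hs

lemma hasDerivAt_x : HasDerivAt x (deriv x s) s :=
  ((h.contDiffOn_x.differentiableOn (by simp)).differentiableAt (h.mem_nhds hs)).hasDerivAt

lemma hasDerivAt_w : HasDerivAt w (deriv w s) s :=
  ((h.contDiffOn_w.differentiableOn (by simp)).differentiableAt (h.mem_nhds hs)).hasDerivAt

omit hs in
lemma contDiffOn_deriv_x : ContDiffOn ℝ ∞ (deriv x) I :=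
  h.contDiffOn_x.deriv_of_isOpen h.isOpen (by simp)

omit hs in
lemma contDiffOn_deriv_w : ContDiffOn ℝ ∞ (deriv w) I :=
  h.contDiffOn_w.deriv_of_isOpen h.isOpen (by simp)

lemma hasDerivAt_deriv_x' : HasDerivAt (deriv x) (deriv (deriv x) s) s :=
  ((h.contDiffOn_deriv_x.differentiableOn (by simp)).differentiableAt (h.mem_nhds hs)).hasDerivAt

lemma hasDerivAt_deriv_w' : HasDerivAt (deriv w) (deriv (deriv w) s) s :=
  ((h.contDiffOn_deriv_w.differentiableOn (by simp)).differentiableAt (h.mem_nhds hs)).hasDerivAt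

/-- Derivative of the unit-speed relation: the acceleration of the profile is orthogonal to its
velocity, hence a multiple κ of the normal (w', x'). -/
lemma deriv_mul_deriv_deriv :
    deriv x s * deriv (deriv x) s = deriv w s * deriv (deriv w) s := by
  have h1 : HasDerivAt (fun s => deriv x s ^ 2 - deriv w s ^ 2) 0 s :=
    (hasDerivAt_const s (-1 : ℝ)).congr_of_eventuallyEq
      (by filter_upwards [h.mem_nhds hs] with σ hσ using h.unit σ hσ)
  have h2 := h1.unique (((h.hasDerivAt_deriv_x' hs).pow 2).sub ((h.hasDerivAt_deriv_w' hs).pow 2))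
  simp only [Nat.cast_ofNat, Nat.add_one_sub_one, pow_one] at h2
  linear_combination -h2 / 2

lemma hasDerivAt_deriv_x : HasDerivAt (deriv x) (curvProfile x w s * deriv w s) s := by
  refine (h.hasDerivAt_deriv_x' hs).congr_deriv ?_
  rw [curvProfile]
  linear_combination deriv (deriv x) s * h.unit s hs
    - deriv x s * h.deriv_mul_deriv_deriv hs

lemma hasDerivAt_deriv_w : HasDerivAt (deriv w) (curvProfile x w s * deriv x s) s := by
  refine (h.hasDerivAt_deriv_w' hs).congr_deriv ?_
  rw [curvProfile]
  linear_combination deriv (deriv w) s * h.unit s hs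
    - deriv w s * h.deriv_mul_deriv_deriv hs

lemma hasDerivAt_speedSq : HasDerivAt (fun s => a ^ 2 * x s ^ 2 + b ^ 2 * w s ^ 2)
    (2 * tangentCoeff a b x w s * (a ^ 2 * x s ^ 2 + b ^ 2 * w s ^ 2)) s := by
  have hq := (h.pos s hs).ne'
  refine ((((h.hasDerivAt_x hs).pow 2).const_mul (a ^ 2)).add
    (((h.hasDerivAt_w hs).pow 2).const_mul (b ^ 2))).congr_deriv ?_
  rw [tangentCoeff]
  field_simp
  push_cast
  ring

lemma hasDerivAt_speed :
    HasDerivAt (speed a b x w) (speed a b x w s * tangentCoeff a b x w s) s := by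
  refine ((h.hasDerivAt_speedSq hs).sqrt (h.pos s hs).ne').congr_deriv ?_
  have hG := (h.speed_pos hs).ne'
  rw [← h.speed_sq hs, Real.sqrt_sq (h.speed_pos hs).le]
  field_simp

lemma hasDerivAt_curvProfile :
    HasDerivAt (curvProfile x w) (deriv (curvProfile x w) s) s := by
  have h1 : ContDiffOn ℝ ∞ (curvProfile x w) I :=
    ((h.contDiffOn_deriv_x.deriv_of_isOpen h.isOpen (by simp)).mul h.contDiffOn_deriv_w).sub
      ((h.contDiffOn_deriv_w.deriv_of_isOpen h.isOpen (by simp)).mul h.contDiffOn_deriv_x)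
  exact ((h1.differentiableOn (by simp)).differentiableAt (h.mem_nhds hs)).hasDerivAt

/-- The Codazzi equation for `μ`. -/
lemma hasDerivAt_curvOrbit : HasDerivAt (curvOrbit a b x w)
    (-tangentCoeff a b x w s * (curvProfile x w s + curvOrbit a b x w s)
      - torsionCoeff a b x w s * normalCoeff a b x w s) s := by
  have hq := (h.pos s hs).ne'
  refine (((((h.hasDerivAt_x hs).const_mul (a ^ 2)).mul (h.hasDerivAt_deriv_w hs)).add
    (((h.hasDerivAt_w hs).const_mul (b ^ 2)).mul (h.hasDerivAt_deriv_x hs))).neg.div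
    (h.hasDerivAt_speedSq hs) hq).congr_deriv ?_
  rw [tangentCoeff, curvOrbit, torsionCoeff, normalCoeff]
  field_simp
  simp only [Pi.add_apply, Pi.mul_apply, Pi.neg_apply]
  ring

/-- The Codazzi equation for `ω`. -/
lemma hasDerivAt_torsionCoeff : HasDerivAt (torsionCoeff a b x w)
    (curvProfile x w s * normalCoeff a b x w s
      - 2 * tangentCoeff a b x w s * torsionCoeff a b x w s) s := by
  have hq := (h.pos s hs).ne'
  refine (((((h.hasDerivAt_x hs).mul (h.hasDerivAt_deriv_w hs)).sub
    ((h.hasDerivAt_w hs).mul (h.hasDerivAt_deriv_x hs))).const_mul (a * b)).div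
    (h.hasDerivAt_speedSq hs) hq).congr_deriv ?_
  rw [tangentCoeff, torsionCoeff, normalCoeff]
  field_simp
  simp only [Pi.sub_apply, Pi.mul_apply]
  ring

/-! ### Structure equations -/

variable (t : ℝ)

lemma hasDerivAt_frameS :
    HasDerivAt (fun s => frameS a b x w s t) (curvProfile x w s • frameN₃ a b x w s t) s := by
  rw [frameN₃, smul_rotVec, mul_zero]
  exact hasDerivAt_rotVec_coeff a b t (h.hasDerivAt_deriv_x hs) (hasDerivAt_const _ _)
    (hasDerivAt_const _ _) (h.hasDerivAt_deriv_w hs)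

lemma hasDerivAt_frameN₃ :
    HasDerivAt (fun s => frameN₃ a b x w s t) (curvProfile x w s • frameS a b x w s t) s := by
  rw [frameS, smul_rotVec, mul_zero]
  exact hasDerivAt_rotVec_coeff a b t (h.hasDerivAt_deriv_w hs) (hasDerivAt_const _ _)
    (hasDerivAt_const _ _) (h.hasDerivAt_deriv_x hs)

/-- The pair (ax, bw)/`speed` runs on the Euclidean unit circle, and ω is its angular velocity; this
lemma and the next are the derivatives of its cosine and sine. -/
lemma hasDerivAt_x_div_speed : HasDerivAt (fun s => a * x s / speed a b x w s)
    (torsionCoeff a b x w s * (-(b * w s) / speed a b x w s)) s := by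
  have hG := (h.speed_pos hs).ne'
  have hq := (h.pos s hs).ne'
  refine (((h.hasDerivAt_x hs).const_mul a).div (h.hasDerivAt_speed hs) hG).congr_deriv ?_
  rw [torsionCoeff, tangentCoeff]
  field_simp
  ring

lemma hasDerivAt_w_div_speed : HasDerivAt (fun s => b * w s / speed a b x w s)
    (torsionCoeff a b x w s * (a * x s / speed a b x w s)) s := by
  have hG := (h.speed_pos hs).ne'
  have hq := (h.pos s hs).ne'
  refine (((h.hasDerivAt_w hs).const_mul b).div (h.hasDerivAt_speed hs) hG).congr_deriv ?_
  rw [torsionCoeff, tangentCoeff]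
  field_simp
  ring

lemma hasDerivAt_frameT :
    HasDerivAt (fun s => frameT a b x w s t) (torsionCoeff a b x w s • frameN₄ a b x w s t) s := by
  rw [frameN₄, smul_rotVec, mul_zero]
  exact hasDerivAt_rotVec_coeff a b t (hasDerivAt_const _ _) (h.hasDerivAt_x_div_speed hs)
    (h.hasDerivAt_w_div_speed hs) (hasDerivAt_const _ _)

lemma hasDerivAt_frameN₄ : HasDerivAt (fun s => frameN₄ a b x w s t)
    (-torsionCoeff a b x w s • frameT a b x w s t) s := by
  rw [frameT, smul_rotVec, mul_zero]
  refine hasDerivAt_rotVec_coeff a b t (hasDerivAt_const _ _) ?_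
    ((h.hasDerivAt_x_div_speed hs).congr_deriv (by ring)) (hasDerivAt_const _ _)
  refine ((h.hasDerivAt_w_div_speed hs).neg.congr_deriv (by ring)).congr_of_eventuallyEq
    (Eventually.of_forall fun s => ?_)
  exact neg_div _ _

lemma hasDerivAt_frameS_angle : HasDerivAt (fun t => frameS a b x w s t)
    ((speed a b x w s * tangentCoeff a b x w s) • frameT a b x w s t +
      (speed a b x w s * torsionCoeff a b x w s) • frameN₄ a b x w s t) t := by
  have hG := (h.speed_pos hs).ne'
  have hq := (h.pos s hs).ne'
  refine (hasDerivAt_rotVec_angle a b t _ _ _ _).congr_deriv ?_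
  rw [frameT, frameN₄, smul_rotVec, smul_rotVec, rotVec_add, tangentCoeff, torsionCoeff]
  congr 1 <;> field_simp <;> ring

lemma hasDerivAt_frameT_angle : HasDerivAt (fun t => frameT a b x w s t)
    ((speed a b x w s * curvOrbit a b x w s) • frameN₃ a b x w s t +
      (speed a b x w s * tangentCoeff a b x w s) • frameS a b x w s t) t := by
  have hG := (h.speed_pos hs).ne'
  have hq := (h.pos s hs).ne'
  have hG2 := h.speed_sq hs
  have hu := h.unit s hs
  refine (hasDerivAt_rotVec_angle a b t _ _ _ _).congr_deriv ?_
  rw [frameN₃, frameS, smul_rotVec, smul_rotVec, rotVec_add, tangentCoeff, curvOrbit, ← hG2]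
  congr 1 <;> field_simp
  -- Resolving a vector along the orthonormal pair (x', w'), (w', x') uses the unit-speed relation.
  · linear_combination -a ^ 2 * x s * hu
  · ring
  · ring
  · linear_combination b ^ 2 * w s * hu

lemma hasDerivAt_frameN₃_angle : HasDerivAt (fun t => frameN₃ a b x w s t)
    (-(speed a b x w s * curvOrbit a b x w s) • frameT a b x w s t +
      (speed a b x w s * normalCoeff a b x w s) • frameN₄ a b x w s t) t := by
  have hG := (h.speed_pos hs).ne'
  have hq := (h.pos s hs).ne'
  refine (hasDerivAt_rotVec_angle a b t _ _ _ _).congr_deriv ?_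
  rw [frameT, frameN₄, smul_rotVec, smul_rotVec, rotVec_add, curvOrbit, normalCoeff]
  congr 1 <;> field_simp <;> ring

lemma hasDerivAt_frameN₄_angle : HasDerivAt (fun t => frameN₄ a b x w s t)
    ((speed a b x w s * torsionCoeff a b x w s) • frameS a b x w s t +
      -(speed a b x w s * normalCoeff a b x w s) • frameN₃ a b x w s t) t := by
  have hG := (h.speed_pos hs).ne'
  have hq := (h.pos s hs).ne'
  have hG2 := h.speed_sq hs
  have hu := h.unit s hs
  refine (hasDerivAt_rotVec_angle a b t _ _ _ _).congr_deriv ?_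
  rw [frameN₃, frameS, smul_rotVec, smul_rotVec, rotVec_add, torsionCoeff, normalCoeff, ← hG2]
  congr 1 <;> field_simp
  · linear_combination a * b * w s * hu
  · ring
  · ring
  · linear_combination a * b * x s * hu

end IsProfile

/-! ### Partial derivatives -/

section PartialDerivatives

variable {V : Type*} [NormedAddCommGroup V] [NormedSpace ℝ V]

lemma pd_zero_eq {φ : ℝ × ℝ → V} {p : ℝ × ℝ} {v : V}
    (h : HasDerivAt (fun s => φ (s, p.2)) v p.1) : pd 0 φ p = v := by
  rw [pd, if_pos rfl, h.deriv]

lemma pd_one_eq {φ : ℝ × ℝ → V} {p : ℝ × ℝ} {v : V}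
    (h : HasDerivAt (fun t => φ (p.1, t)) v p.2) : pd 1 φ p = v := by
  rw [pd, if_neg one_ne_zero, h.deriv]

lemma eventually_slice_fst {p : ℝ × ℝ} {P : ℝ × ℝ → Prop} (h : ∀ᶠ q in 𝓝 p, P q) :
    ∀ᶠ s in 𝓝 p.1, P (s, p.2) :=
  (Continuous.prodMk_left p.2).continuousAt (x := p.1) |>.eventually h

lemma eventually_slice_snd {p : ℝ × ℝ} {P : ℝ × ℝ → Prop} (h : ∀ᶠ q in 𝓝 p, P q) :
    ∀ᶠ t in 𝓝 p.2, P (p.1, t) :=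
  (Continuous.prodMk_right p.1).continuousAt (x := p.2) |>.eventually h

lemma pd_congr {φ ψ : ℝ × ℝ → V} {p : ℝ × ℝ} (h : φ =ᶠ[𝓝 p] ψ) (i : Fin 2) :
    pd i φ p = pd i ψ p := by
  fin_cases i
  · exact Filter.EventuallyEq.deriv_eq (eventually_slice_fst h)
  · exact Filter.EventuallyEq.deriv_eq (eventually_slice_snd h)

lemma pd_eventuallyEq {φ ψ : ℝ × ℝ → V} {p : ℝ × ℝ} (h : φ =ᶠ[𝓝 p] ψ) (i : Fin 2) :
    pd i φ =ᶠ[𝓝 p] pd i ψ := by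
  filter_upwards [eventually_eventually_nhds.2 h] with q hq using pd_congr hq i

end PartialDerivatives

/-- Locality is needed because an arbitrary Gauss map agrees with the adapted one only on the
parameter domain. -/
lemma laplacian_congr (r : ℝ × ℝ → E41) {φ ψ : ℝ × ℝ → ℝ} {p : ℝ × ℝ} (h : φ =ᶠ[𝓝 p] ψ) :
    laplacian r φ p = laplacian r ψ p := by
  unfold laplacian
  congr 1
  refine Finset.sum_congr rfl fun i _ => pd_congr ?_ i
  filter_upwards [pd_eventuallyEq h 0, pd_eventuallyEq h 1] with q h0 h1
  simp only [Fin.sum_univ_two, h0, h1]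

/-! ### Linear algebra of the metric -/

lemma mink_smul_left (c : ℝ) (u v : E41) : mink (c • u) v = c * mink u v := by
  simp only [mink, Pi.smul_apply, smul_eq_mul]; ring

lemma mink_smul_right (c : ℝ) (u v : E41) : mink u (c • v) = c * mink u v := by
  simp only [mink, Pi.smul_apply, smul_eq_mul]; ring

lemma mink_add_left (u u' v : E41) : mink (u + u') v = mink u v + mink u' v := by
  simp only [mink, Pi.add_apply]; ring

lemma mink_add_right (u v v' : E41) : mink u (v + v') = mink u v + mink u v' := by
  simp only [mink, Pi.add_apply]; ring

lemma mink_comm (u v : E41) : mink u v = mink v u := by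
  simp only [mink]; ring

namespace IsProfile

variable {a b : ℝ} {I : Set ℝ} {x w : ℝ → ℝ} (h : IsProfile a b I x w)

include h

section Frame

variable {s : ℝ} (hs : s ∈ I) (t : ℝ)

include hs

lemma mink_frameS_frameS : mink (frameS a b x w s t) (frameS a b x w s t) = -1 := by
  rw [frameS, mink_rotVec]
  linear_combination h.unit s hs

lemma mink_frameT_frameT : mink (frameT a b x w s t) (frameT a b x w s t) = 1 := by
  have hG := (h.speed_pos hs).ne'
  rw [frameT, mink_rotVec]
  field_simp
  linear_combination -h.speed_sq hs

lemma mink_frameN₃_frameN₃ : mink (frameN₃ a b x w s t) (frameN₃ a b x w s t) = 1 := by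
  rw [frameN₃, mink_rotVec]
  linear_combination -h.unit s hs

lemma mink_frameN₄_frameN₄ : mink (frameN₄ a b x w s t) (frameN₄ a b x w s t) = 1 := by
  have hG := (h.speed_pos hs).ne'
  rw [frameN₄, mink_rotVec]
  field_simp
  linear_combination -h.speed_sq hs

omit h hs

lemma mink_frameS_frameT : mink (frameS a b x w s t) (frameT a b x w s t) = 0 := by
  rw [frameS, frameT, mink_rotVec]; ring

lemma mink_frameS_frameN₃ : mink (frameS a b x w s t) (frameN₃ a b x w s t) = 0 := by
  rw [frameS, frameN₃, mink_rotVec]; ring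

lemma mink_frameS_frameN₄ : mink (frameS a b x w s t) (frameN₄ a b x w s t) = 0 := by
  rw [frameS, frameN₄, mink_rotVec]; ring

lemma mink_frameT_frameN₃ : mink (frameT a b x w s t) (frameN₃ a b x w s t) = 0 := by
  rw [frameT, frameN₃, mink_rotVec]; ring

lemma mink_frameT_frameN₄ : mink (frameT a b x w s t) (frameN₄ a b x w s t) = 0 := by
  rw [frameT, frameN₄, mink_rotVec]; ring

lemma mink_frameN₃_frameN₄ : mink (frameN₃ a b x w s t) (frameN₄ a b x w s t) = 0 := by
  rw [frameN₃, frameN₄, mink_rotVec]; ring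

include h hs

/-- Expansion of a normal vector in the normal frame. -/
lemma normal_expansion {v : E41} (hS : mink (frameS a b x w s t) v = 0)
    (hT : mink (frameT a b x w s t) v = 0) :
    v = mink v (frameN₃ a b x w s t) • frameN₃ a b x w s t +
      mink v (frameN₄ a b x w s t) • frameN₄ a b x w s t := by
  obtain ⟨p, q, m, n, rfl⟩ := exists_eq_rotVec a b t v
  have hG := (h.speed_pos hs).ne'
  have hG2 := h.speed_sq hs
  have hu := h.unit s hs
  rw [frameS, mink_rotVec] at hS
  rw [frameT, mink_rotVec] at hT
  rw [frameN₃, frameN₄, mink_rotVec, mink_rotVec, smul_rotVec, smul_rotVec, rotVec_add]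
  have hT' : q * (a * x s) + m * (b * w s) = 0 := by
    field_simp at hT
    linear_combination hT
  congr 1
  · linear_combination p * hu - deriv x s * hS
  · field_simp
    linear_combination q * hG2 + a * x s * hT'
  · field_simp
    linear_combination m * hG2 + b * w s * hT'
  · linear_combination n * hu - deriv w s * hS

end Frame

section Surface

variable {p : ℝ × ℝ} (hp : p.1 ∈ I)

include hp

lemma pd_zero_doubleRotational :
    pd 0 (doubleRotational a b x w) p = frameS a b x w p.1 p.2 := by
  refine pd_zero_eq ?_
  simp only [doubleRotational_eq]
  exact hasDerivAt_rotVec_coeff a b p.2 (h.hasDerivAt_x hp) (hasDerivAt_const _ _)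
    (hasDerivAt_const _ _) (h.hasDerivAt_w hp)

lemma pd_one_doubleRotational :
    pd 1 (doubleRotational a b x w) p = speed a b x w p.1 • frameT a b x w p.1 p.2 := by
  have hG := (h.speed_pos hp).ne'
  refine pd_one_eq ?_
  simp only [doubleRotational_eq]
  refine (hasDerivAt_rotVec_angle a b p.2 _ _ _ _).congr_deriv ?_
  rw [frameT, smul_rotVec]
  congr 1 <;> field_simp <;> ring

lemma firstForm_eq : firstForm (doubleRotational a b x w) p =
    !![-1, 0; 0, speed a b x w p.1 ^ 2] := by
  ext i j
  fin_cases i <;> fin_cases j <;>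
    simp [firstForm, h.pd_zero_doubleRotational hp, h.pd_one_doubleRotational hp, mink_smul_left,
      mink_smul_right, h.mink_frameS_frameS hp, h.mink_frameT_frameT hp, mink_frameS_frameT,
      mink_comm (frameT a b x w p.1 p.2), pow_two]

lemma firstForm_inv : (firstForm (doubleRotational a b x w) p)⁻¹ =
    !![-1, 0; 0, (speed a b x w p.1 ^ 2)⁻¹] := by
  have hG := (h.speed_pos hp).ne'
  rw [h.firstForm_eq hp]
  refine Matrix.inv_eq_right_inv ?_
  ext i j
  fin_cases i <;> fin_cases j <;> simp [Matrix.mul_apply, Fin.sum_univ_two, hG]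

lemma sqrt_abs_det_firstForm :
    Real.sqrt |(firstForm (doubleRotational a b x w) p).det| = speed a b x w p.1 := by
  rw [h.firstForm_eq hp, Matrix.det_fin_two_of]
  simp [abs_of_pos (h.speed_pos hp), Real.sqrt_sq_eq_abs]

lemma eventually_mem : ∀ᶠ q : ℝ × ℝ in 𝓝 p, q.1 ∈ I :=
  continuous_fst.continuousAt.eventually (h.mem_nhds hp)

/-- The metric is diag(-1, `speed`²), so the divergence formula needs only the logarithmic
derivative of `speed`. Here φt and φtt are derivatives along the unit field T, which keeps `speed`
out of the result. -/
lemma laplacian_eq {φ φs φt : ℝ × ℝ → ℝ} {φss φtt : ℝ}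
    (h1 : ∀ q : ℝ × ℝ, q.1 ∈ I → HasDerivAt (fun s => φ (s, q.2)) (φs q) q.1)
    (h2 : ∀ q : ℝ × ℝ, q.1 ∈ I →
      HasDerivAt (fun t => φ (q.1, t)) (speed a b x w q.1 * φt q) q.2)
    (h11 : HasDerivAt (fun s => φs (s, p.2)) φss p.1)
    (h22 : HasDerivAt (fun t => φt (p.1, t)) (speed a b x w p.1 * φtt) p.2) :
    laplacian (doubleRotational a b x w) φ p =
      φss + tangentCoeff a b x w p.1 * φs p - φtt := by
  have hG := (h.speed_pos hp).ne'
  rw [laplacian, h.sqrt_abs_det_firstForm hp, Fin.sum_univ_two]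
  have e0 : pd 0 (fun q => Real.sqrt |(firstForm (doubleRotational a b x w) q).det| *
      ∑ j, (firstForm (doubleRotational a b x w) q)⁻¹ 0 j * pd j φ q) p =
      pd 0 (fun q => -(speed a b x w q.1 * φs q)) p := by
    refine pd_congr ?_ 0
    filter_upwards [h.eventually_mem hp] with q hq
    rw [h.sqrt_abs_det_firstForm hq, h.firstForm_inv hq, Fin.sum_univ_two, pd_zero_eq (h1 q hq)]
    simp
  have e1 : pd 1 (fun q => Real.sqrt |(firstForm (doubleRotational a b x w) q).det| *
      ∑ j, (firstForm (doubleRotational a b x w) q)⁻¹ 1 j * pd j φ q) p = pd 1 φt p := by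
    refine pd_congr ?_ 1
    filter_upwards [h.eventually_mem hp] with q hq
    have hGq := (h.speed_pos hq).ne'
    rw [h.sqrt_abs_det_firstForm hq, h.firstForm_inv hq, Fin.sum_univ_two, pd_one_eq (h2 q hq)]
    simp
    field_simp
  rw [e0, e1, pd_one_eq h22, pd_zero_eq ((h.hasDerivAt_speed hp).mul h11).neg]
  field_simp
  ring

end Surface

end IsProfile

/-! ### The Gauss map and its Laplacian in the adapted frame -/

lemma isOpen_paramDomain {I : Set ℝ} (hI : IsOpen I) : IsOpen (paramDomain I) :=
  hI.prod isOpen_Ioo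

/-- The Gauss map of a double rotational surface in the adapted frame. -/
noncomputable def adaptedGaussMap (a b : ℝ) (x w : ℝ → ℝ) (p : ℝ × ℝ) : ⋀[ℝ]^2 E41 :=
  wedge (frameN₃ a b x w p.1 p.2) (frameN₄ a b x w p.1 p.2)

namespace IsProfile

variable {a b : ℝ} {I : Set ℝ} {x w : ℝ → ℝ} (h : IsProfile a b I x w)

include h

section Pointwise

variable {p : ℝ × ℝ} (hp : p.1 ∈ I)

include hp

/-- The adapted frame is positively oriented, so the sign of the determinant is that of the change
of basis in the normal plane. -/
lemma det_frame (α β γ δ : ℝ) :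
    (Matrix.of ![pd 0 (doubleRotational a b x w) p, pd 1 (doubleRotational a b x w) p,
      α • frameN₃ a b x w p.1 p.2 + β • frameN₄ a b x w p.1 p.2,
      γ • frameN₃ a b x w p.1 p.2 + δ • frameN₄ a b x w p.1 p.2]).det =
    (α * δ - β * γ) * speed a b x w p.1 := by
  have hG := (h.speed_pos hp).ne'
  rw [h.pd_zero_doubleRotational hp, h.pd_one_doubleRotational hp, frameS, frameT, frameN₃,
    frameN₄]
  simp only [smul_rotVec, rotVec_add]
  rw [det_rotVec]
  simp [Matrix.det_succ_row_zero, Fin.sum_univ_succ, Fin.succAbove]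
  field_simp
  linear_combination (-(α * δ - β * γ) * (a ^ 2 * x p.1 ^ 2 + b ^ 2 * w p.1 ^ 2)) * h.unit p.1 hp
    - (α * δ - β * γ) * h.speed_sq hp

/-- The Gauss map does not depend on the chosen normal frame. -/
lemma wedge_eq_adaptedGaussMap {e₃ e₄ : E41} (h33 : mink e₃ e₃ = 1) (h44 : mink e₄ e₄ = 1)
    (h34 : mink e₃ e₄ = 0)
    (hn : ∀ i, mink (pd i (doubleRotational a b x w) p) e₃ = 0 ∧
      mink (pd i (doubleRotational a b x w) p) e₄ = 0)
    (hdet : 0 < (Matrix.of ![pd 0 (doubleRotational a b x w) p,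
      pd 1 (doubleRotational a b x w) p, e₃, e₄]).det) :
    wedge e₃ e₄ = adaptedGaussMap a b x w p := by
  have hG := h.speed_pos hp
  have n0 := hn 0
  have n1 := hn 1
  rw [h.pd_zero_doubleRotational hp] at n0
  rw [h.pd_one_doubleRotational hp, mink_smul_left, mink_smul_left, mul_eq_zero, mul_eq_zero,
    or_iff_right hG.ne', or_iff_right hG.ne'] at n1
  obtain ⟨α, β, rfl⟩ : ∃ α β : ℝ, e₃ = α • frameN₃ a b x w p.1 p.2 + β • frameN₄ a b x w p.1 p.2 :=
    ⟨_, _, h.normal_expansion hp p.2 n0.1 n1.1⟩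
  obtain ⟨γ, δ, rfl⟩ : ∃ γ δ : ℝ, e₄ = γ • frameN₃ a b x w p.1 p.2 + δ • frameN₄ a b x w p.1 p.2 :=
    ⟨_, _, h.normal_expansion hp p.2 n0.2 n1.2⟩
  simp only [mink_add_left, mink_add_right, mink_smul_left, mink_smul_right,
    h.mink_frameN₃_frameN₃ hp, h.mink_frameN₄_frameN₄ hp, mink_frameN₃_frameN₄,
    mink_comm (frameN₄ a b x w p.1 p.2) (frameN₃ a b x w p.1 p.2)] at h33 h44 h34
  rw [h.det_frame hp] at hdet
  have hpos : 0 < α * δ - β * γ := pos_of_mul_pos_left hdet hG.le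
  have hone : α * δ - β * γ = 1 := by
    -- The change between two orthonormal bases of the normal plane has squared determinant 1; the
    -- orientation then excludes -1.
    have h2 : (α * δ - β * γ) ^ 2 = 1 := by
      linear_combination (γ ^ 2 + δ ^ 2) * h33 + h44 - (α * γ + β * δ) * h34
    exact (pow_eq_one_iff_of_nonneg hpos.le two_ne_zero).1 h2
  simp only [adaptedGaussMap, wedge_add_left, wedge_add_right, wedge_smul_left, wedge_smul_right,
    wedge_self, wedge_comm (frameN₄ a b x w p.1 p.2) (frameN₃ a b x w p.1 p.2)]
  refine Eq.trans ?_ ((congrArg (· • _) hone).trans (one_smul ℝ _))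
  module

end Pointwise

lemma isGaussMap_adaptedGaussMap : IsGaussMap (doubleRotational a b x w) (paramDomain I)
    (adaptedGaussMap a b x w) := by
  rintro p ⟨hp, -⟩
  refine ⟨frameN₃ a b x w p.1 p.2, frameN₄ a b x w p.1 p.2, h.mink_frameN₃_frameN₃ hp _,
    h.mink_frameN₄_frameN₄ hp _, mink_frameN₃_frameN₄ _, ?_, ?_, rfl⟩
  · intro i
    fin_cases i
    · simp [h.pd_zero_doubleRotational hp, mink_frameS_frameN₃, mink_frameS_frameN₄]
    · simp [h.pd_one_doubleRotational hp, mink_smul_left, mink_frameT_frameN₃,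
        mink_frameT_frameN₄]
  · have := h.det_frame hp 1 0 0 1
    simp only [one_smul, zero_smul, add_zero, zero_add] at this
    rw [this]
    simpa using h.speed_pos hp

lemma eqOn_adaptedGaussMap {ν : ℝ × ℝ → ⋀[ℝ]^2 E41}
    (hν : IsGaussMap (doubleRotational a b x w) (paramDomain I) ν) :
    Set.EqOn ν (adaptedGaussMap a b x w) (paramDomain I) := by
  intro p hp
  obtain ⟨e₃, e₄, h33, h44, h34, hn, hdet, hν⟩ := hν p hp
  rw [hν, h.wedge_eq_adaptedGaussMap hp.1 h33 h44 h34 hn hdet]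

/-- The Laplacian of the Gauss map in the adapted frame. -/
lemma laplacian_adaptedGaussMap {p : ℝ × ℝ} (hp : p.1 ∈ I) (ℓ : (⋀[ℝ]^2 E41) →ₗ[ℝ] ℝ) :
    laplacian (doubleRotational a b x w) (fun q => ℓ (adaptedGaussMap a b x w q)) p =
      (curvProfile x w p.1 ^ 2 + curvOrbit a b x w p.1 ^ 2 - 2 * torsionCoeff a b x w p.1 ^ 2) *
        ℓ (adaptedGaussMap a b x w p) +
      (deriv (curvProfile x w) p.1 - deriv (curvOrbit a b x w) p.1) *
        ℓ (wedge (frameS a b x w p.1 p.2) (frameN₄ a b x w p.1 p.2)) -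
      2 * (torsionCoeff a b x w p.1 * (curvProfile x w p.1 + curvOrbit a b x w p.1)) *
        ℓ (wedge (frameS a b x w p.1 p.2) (frameT a b x w p.1 p.2)) +
      (curvOrbit a b x w p.1 - curvProfile x w p.1) * normalCoeff a b x w p.1 *
        ℓ (wedge (frameN₃ a b x w p.1 p.2) (frameT a b x w p.1 p.2)) := by
  -- The supplied first derivatives of ν are κ S ∧ N₄ - ω N₃ ∧ T along S and -μ T ∧ N₄ + ω N₃ ∧ S
  -- along T.
  rw [h.laplacian_eq hp (φ := fun q => ℓ (adaptedGaussMap a b x w q))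
    (φs := fun q => curvProfile x w q.1 *
        ℓ (wedge (frameS a b x w q.1 q.2) (frameN₄ a b x w q.1 q.2)) -
      torsionCoeff a b x w q.1 * ℓ (wedge (frameN₃ a b x w q.1 q.2) (frameT a b x w q.1 q.2)))
    (φt := fun q => -curvOrbit a b x w q.1 *
        ℓ (wedge (frameT a b x w q.1 q.2) (frameN₄ a b x w q.1 q.2)) +
      torsionCoeff a b x w q.1 * ℓ (wedge (frameN₃ a b x w q.1 q.2) (frameS a b x w q.1 q.2)))
    ?_ ?_
    (((h.hasDerivAt_curvProfile hp).mul
        (hasDerivAt_wedge ℓ (h.hasDerivAt_frameS hp p.2) (h.hasDerivAt_frameN₄ hp p.2))).sub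
      ((h.hasDerivAt_torsionCoeff hp).mul
        (hasDerivAt_wedge ℓ (h.hasDerivAt_frameN₃ hp p.2) (h.hasDerivAt_frameT hp p.2))))
    (φtt := (torsionCoeff a b x w p.1 ^ 2 - curvOrbit a b x w p.1 ^ 2) *
        ℓ (adaptedGaussMap a b x w p) -
      (curvOrbit a b x w p.1 * tangentCoeff a b x w p.1 +
          torsionCoeff a b x w p.1 * normalCoeff a b x w p.1) *
        ℓ (wedge (frameS a b x w p.1 p.2) (frameN₄ a b x w p.1 p.2)) +
      2 * curvOrbit a b x w p.1 * torsionCoeff a b x w p.1 *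
        ℓ (wedge (frameS a b x w p.1 p.2) (frameT a b x w p.1 p.2)) +
      (torsionCoeff a b x w p.1 * tangentCoeff a b x w p.1 -
          curvOrbit a b x w p.1 * normalCoeff a b x w p.1) *
        ℓ (wedge (frameN₃ a b x w p.1 p.2) (frameT a b x w p.1 p.2)))]
  -- The coefficient of S ∧ N₄ comes out as κ' + λ(κ + μ) + ωη; the Codazzi equation identifies it
  -- with κ' - μ'.
  · rw [(h.hasDerivAt_curvOrbit hp).deriv]
    simp only [adaptedGaussMap, wedge_smul_left, wedge_smul_right, map_smul, smul_eq_mul]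
    ring
  · refine (((hasDerivAt_wedge ℓ (h.hasDerivAt_frameT_angle hp p.2)
        (h.hasDerivAt_frameN₄_angle hp p.2)).const_mul (-curvOrbit a b x w p.1)).add
      ((hasDerivAt_wedge ℓ (h.hasDerivAt_frameN₃_angle hp p.2)
        (h.hasDerivAt_frameS_angle hp p.2)).const_mul
          (torsionCoeff a b x w p.1))).congr_deriv ?_
    simp only [adaptedGaussMap, wedge_add_left, wedge_add_right, wedge_smul_left,
      wedge_smul_right, map_add, map_smul, smul_eq_mul,
      wedge_comm (frameT a b x w p.1 p.2) (frameN₃ a b x w p.1 p.2),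
      wedge_comm (frameT a b x w p.1 p.2) (frameS a b x w p.1 p.2),
      wedge_comm (frameN₄ a b x w p.1 p.2) (frameS a b x w p.1 p.2), map_neg]
    ring
  · intro q hq
    refine (hasDerivAt_wedge ℓ (h.hasDerivAt_frameN₃ hq q.2)
      (h.hasDerivAt_frameN₄ hq q.2)).congr_deriv ?_
    simp only [wedge_smul_left, wedge_smul_right, map_smul, smul_eq_mul]
    ring
  · intro q hq
    refine (hasDerivAt_wedge ℓ (h.hasDerivAt_frameN₃_angle hq q.2)
      (h.hasDerivAt_frameN₄_angle hq q.2)).congr_deriv ?_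
    simp only [wedge_add_left, wedge_add_right, wedge_smul_left, wedge_smul_right, map_add,
      map_smul, smul_eq_mul, wedge_self, map_zero]
    ring

/-! ### The second fundamental form -/

section SecondForm

variable {p : ℝ × ℝ} (hp : p.1 ∈ I)

include hp

lemma pd_zero_pd_zero : pd 0 (pd 0 (doubleRotational a b x w)) p =
    curvProfile x w p.1 • frameN₃ a b x w p.1 p.2 := by
  rw [pd_congr (ψ := fun q => frameS a b x w q.1 q.2)
    (by filter_upwards [h.eventually_mem hp] with q hq using h.pd_zero_doubleRotational hq)]
  exact pd_zero_eq (h.hasDerivAt_frameS hp p.2)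

lemma pd_one_pd_zero : pd 1 (pd 0 (doubleRotational a b x w)) p =
    (speed a b x w p.1 * tangentCoeff a b x w p.1) • frameT a b x w p.1 p.2 +
      (speed a b x w p.1 * torsionCoeff a b x w p.1) • frameN₄ a b x w p.1 p.2 := by
  rw [pd_congr (ψ := fun q => frameS a b x w q.1 q.2)
    (by filter_upwards [h.eventually_mem hp] with q hq using h.pd_zero_doubleRotational hq)]
  exact pd_one_eq (h.hasDerivAt_frameS_angle hp p.2)

lemma pd_zero_pd_one : pd 0 (pd 1 (doubleRotational a b x w)) p =
    (speed a b x w p.1 * tangentCoeff a b x w p.1) • frameT a b x w p.1 p.2 +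
      (speed a b x w p.1 * torsionCoeff a b x w p.1) • frameN₄ a b x w p.1 p.2 := by
  rw [pd_congr (ψ := fun q => speed a b x w q.1 • frameT a b x w q.1 q.2)
    (by filter_upwards [h.eventually_mem hp] with q hq using h.pd_one_doubleRotational hq)]
  rw [pd_zero_eq ((h.hasDerivAt_speed hp).smul (h.hasDerivAt_frameT hp p.2))]
  module

lemma pd_one_pd_one : pd 1 (pd 1 (doubleRotational a b x w)) p =
    (speed a b x w p.1 ^ 2 * curvOrbit a b x w p.1) • frameN₃ a b x w p.1 p.2 +
      (speed a b x w p.1 ^ 2 * tangentCoeff a b x w p.1) • frameS a b x w p.1 p.2 := by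
  rw [pd_congr (ψ := fun q => speed a b x w q.1 • frameT a b x w q.1 q.2)
    (by filter_upwards [h.eventually_mem hp] with q hq using h.pd_one_doubleRotational hq)]
  rw [pd_one_eq ((h.hasDerivAt_frameT_angle hp p.2).const_smul (speed a b x w p.1))]
  module

lemma secondForm_eq (i j : Fin 2) : secondForm (doubleRotational a b x w) i j p =
    pd i (pd j (doubleRotational a b x w)) p +
      mink (pd i (pd j (doubleRotational a b x w)) p) (frameS a b x w p.1 p.2) •
        frameS a b x w p.1 p.2 -
      mink (pd i (pd j (doubleRotational a b x w)) p) (frameT a b x w p.1 p.2) •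
        frameT a b x w p.1 p.2 := by
  have hG := (h.speed_pos hp).ne'
  rw [secondForm, h.firstForm_inv hp]
  simp only [Fin.sum_univ_two, h.pd_zero_doubleRotational hp, h.pd_one_doubleRotational hp,
    mink_smul_right, smul_smul, Matrix.of_apply, Matrix.cons_val]
  match_scalars <;> field_simp <;> ring

lemma secondForm_zero_zero : secondForm (doubleRotational a b x w) 0 0 p =
    curvProfile x w p.1 • frameN₃ a b x w p.1 p.2 := by
  rw [h.secondForm_eq hp, h.pd_zero_pd_zero hp, mink_smul_left, mink_smul_left,
    mink_comm, mink_frameS_frameN₃, mink_comm, mink_frameT_frameN₃]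
  module

lemma secondForm_of_ne {i j : Fin 2} (hij : i ≠ j) :
    secondForm (doubleRotational a b x w) i j p =
      (speed a b x w p.1 * torsionCoeff a b x w p.1) • frameN₄ a b x w p.1 p.2 := by
  have key : pd i (pd j (doubleRotational a b x w)) p =
      (speed a b x w p.1 * tangentCoeff a b x w p.1) • frameT a b x w p.1 p.2 +
      (speed a b x w p.1 * torsionCoeff a b x w p.1) • frameN₄ a b x w p.1 p.2 := by
    fin_cases i <;> fin_cases j
    · exact absurd rfl hij
    · exact h.pd_zero_pd_one hp
    · exact h.pd_one_pd_zero hp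
    · exact absurd rfl hij
  rw [h.secondForm_eq hp, key]
  simp only [mink_add_left, mink_smul_left, h.mink_frameT_frameT hp,
    mink_comm (frameT a b x w p.1 p.2) (frameS a b x w p.1 p.2),
    mink_comm (frameN₄ a b x w p.1 p.2),
    mink_frameS_frameT, mink_frameS_frameN₄, mink_frameT_frameN₄]
  module

lemma secondForm_one_one : secondForm (doubleRotational a b x w) 1 1 p =
    (speed a b x w p.1 ^ 2 * curvOrbit a b x w p.1) • frameN₃ a b x w p.1 p.2 := by
  rw [h.secondForm_eq hp, h.pd_one_pd_one hp]
  simp only [mink_add_left, mink_smul_left, h.mink_frameS_frameS hp,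
    mink_comm (frameN₃ a b x w p.1 p.2), mink_frameS_frameT, mink_frameS_frameN₃,
    mink_frameT_frameN₃]
  module

lemma sqLength_eq : sqLength (doubleRotational a b x w) p =
    curvProfile x w p.1 ^ 2 + curvOrbit a b x w p.1 ^ 2 - 2 * torsionCoeff a b x w p.1 ^ 2 := by
  have hG := (h.speed_pos hp).ne'
  rw [sqLength, h.firstForm_inv hp]
  simp only [Fin.sum_univ_two, h.secondForm_zero_zero hp, h.secondForm_one_one hp,
    h.secondForm_of_ne hp (zero_ne_one (α := Fin 2)),
    h.secondForm_of_ne hp (one_ne_zero (α := Fin 2)), mink_smul_left, mink_smul_right,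
    h.mink_frameN₃_frameN₃ hp, h.mink_frameN₄_frameN₄ hp, Matrix.of_apply, Matrix.cons_val]
  field_simp
  ring

end SecondForm

/-! ### The 1-type condition as three scalar equations -/

/-- If the mean curvature vector is parallel and the normal bundle is flat, which are the three
scalar hypotheses, then `Δ ν = ‖h‖² ν`. -/
lemma gaussMapEq_sqLength
    (h1 : ∀ s ∈ I, deriv (curvProfile x w) s = deriv (curvOrbit a b x w) s)
    (h2 : ∀ s ∈ I, torsionCoeff a b x w s * (curvProfile x w s + curvOrbit a b x w s) = 0)
    (h3 : ∀ s ∈ I, (curvOrbit a b x w s - curvProfile x w s) * normalCoeff a b x w s = 0)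
    {ν : ℝ × ℝ → ⋀[ℝ]^2 E41} (hν : IsGaussMap (doubleRotational a b x w) (paramDomain I) ν) :
    GaussMapEq (doubleRotational a b x w) (paramDomain I) ν
      (sqLength (doubleRotational a b x w)) 0 := by
  intro p hp ℓ
  have he : ν =ᶠ[𝓝 p] adaptedGaussMap a b x w :=
    (h.eqOn_adaptedGaussMap hν).eventuallyEq_of_mem ((isOpen_paramDomain h.isOpen).mem_nhds hp)
  have he' : (fun q => ℓ (ν q)) =ᶠ[𝓝 p] fun q => ℓ (adaptedGaussMap a b x w q) := he.fun_comp ℓ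
  rw [laplacian_congr _ he', h.laplacian_adaptedGaussMap hp.1, h1 _ hp.1, h2 _ hp.1, h3 _ hp.1, he.self_of_nhds,
    h.sqLength_eq hp.1, add_zero, map_smul, smul_eq_mul]
  ring

lemma hasPointwiseOneTypeFirstKind
    (h1 : ∀ s ∈ I, deriv (curvProfile x w) s = deriv (curvOrbit a b x w) s)
    (h2 : ∀ s ∈ I, torsionCoeff a b x w s * (curvProfile x w s + curvOrbit a b x w s) = 0)
    (h3 : ∀ s ∈ I, (curvOrbit a b x w s - curvProfile x w s) * normalCoeff a b x w s = 0) :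
    HasPointwiseOneTypeFirstKind (doubleRotational a b x w) (paramDomain I) := by
  refine ⟨_, _, h.isGaussMap_adaptedGaussMap, ?_,
    h.gaussMapEq_sqLength h1 h2 h3 h.isGaussMap_adaptedGaussMap⟩
  have hx := h.contDiffOn_x
  have hw := h.contDiffOn_w
  have hx' := h.contDiffOn_deriv_x
  have hw' := h.contDiffOn_deriv_w
  have hx'' : ContDiffOn ℝ ∞ (deriv (deriv x)) I := hx'.deriv_of_isOpen h.isOpen (by simp)
  have hw'' : ContDiffOn ℝ ∞ (deriv (deriv w)) I := hw'.deriv_of_isOpen h.isOpen (by simp)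
  have hq : ContDiffOn ℝ ∞ (fun s => a ^ 2 * x s ^ 2 + b ^ 2 * w s ^ 2) I :=
    (contDiffOn_const.mul (hx.pow 2)).add (contDiffOn_const.mul (hw.pow 2))
  have hκ : ContDiffOn ℝ ∞ (curvProfile x w) I := (hx''.mul hw').sub (hw''.mul hx')
  have hμ : ContDiffOn ℝ ∞ (curvOrbit a b x w) I :=
    (((contDiffOn_const.mul hx).mul hw').add ((contDiffOn_const.mul hw).mul hx')).neg.div hq
      fun s hs => (h.pos s hs).ne'
  have hω : ContDiffOn ℝ ∞ (torsionCoeff a b x w) I :=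
    (contDiffOn_const.mul ((hx.mul hw').sub (hw.mul hx'))).div hq fun s hs => (h.pos s hs).ne'
  have hf : ContDiffOn ℝ ∞ (fun s => curvProfile x w s ^ 2 + curvOrbit a b x w s ^ 2 -
      2 * torsionCoeff a b x w s ^ 2) I :=
    ((hκ.pow 2).add (hμ.pow 2)).sub (contDiffOn_const.mul (hω.pow 2))
  -- The factor f = ‖h‖² depends on `s` alone, through κ, μ and ω.
  exact (hf.comp contDiffOn_fst fun p hp => hp.1).congr fun p hp => h.sqLength_eq hp.1

/-- Each equation is isolated by a functional dual to one of S ∧ N₄, S ∧ T, N₃ ∧ T; by orthogonality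
it kills ν and the other two. The value t = π is an arbitrary point of the interval. -/
lemma equations_of_hasPointwiseOneTypeFirstKind
    (hM : HasPointwiseOneTypeFirstKind (doubleRotational a b x w) (paramDomain I)) {s : ℝ}
    (hs : s ∈ I) :
    deriv (curvProfile x w) s = deriv (curvOrbit a b x w) s ∧
      torsionCoeff a b x w s * (curvProfile x w s + curvOrbit a b x w s) = 0 ∧
      (curvOrbit a b x w s - curvProfile x w s) * normalCoeff a b x w s = 0 := by
  obtain ⟨ν, f, hν, -, heq⟩ := hM
  have hp : ((s, Real.pi) : ℝ × ℝ) ∈ paramDomain I :=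
    ⟨hs, Real.pi_pos, by linarith [Real.pi_pos]⟩
  have he : ν =ᶠ[𝓝 (s, Real.pi)] adaptedGaussMap a b x w :=
    (h.eqOn_adaptedGaussMap hν).eventuallyEq_of_mem ((isOpen_paramDomain h.isOpen).mem_nhds hp)
  have key (ℓ : (⋀[ℝ]^2 E41) →ₗ[ℝ] ℝ) := (heq _ hp ℓ).symm.trans
    ((laplacian_congr _ (he.fun_comp ℓ)).trans
      (h.laplacian_adaptedGaussMap (p := (s, Real.pi)) hs ℓ))
  obtain ⟨ℓ₁, hℓ₁⟩ := exists_functional_wedge (frameS a b x w s Real.pi)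
    (frameN₄ a b x w s Real.pi)
  obtain ⟨ℓ₂, hℓ₂⟩ := exists_functional_wedge (frameS a b x w s Real.pi)
    (frameT a b x w s Real.pi)
  obtain ⟨ℓ₃, hℓ₃⟩ := exists_functional_wedge (frameN₃ a b x w s Real.pi)
    (frameT a b x w s Real.pi)
  have k1 := key ℓ₁
  have k2 := key ℓ₂
  have k3 := key ℓ₃
  simp only [he.self_of_nhds, adaptedGaussMap, hℓ₁, hℓ₂, hℓ₃, add_zero, map_smul, smul_eq_mul,
    h.mink_frameS_frameS hs, h.mink_frameT_frameT hs, h.mink_frameN₃_frameN₃ hs,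
    h.mink_frameN₄_frameN₄ hs, mink_frameS_frameT, mink_frameS_frameN₃, mink_frameS_frameN₄,
    mink_frameT_frameN₃, mink_frameT_frameN₄, mink_frameN₃_frameN₄,
    mink_comm (frameT a b x w s Real.pi) (frameS a b x w s Real.pi),
    mink_comm (frameN₃ a b x w s Real.pi) (frameS a b x w s Real.pi),
    mink_comm (frameN₃ a b x w s Real.pi) (frameT a b x w s Real.pi),
    mink_comm (frameN₄ a b x w s Real.pi) (frameS a b x w s Real.pi),
    mink_comm (frameN₄ a b x w s Real.pi) (frameT a b x w s Real.pi),
    mink_comm (frameN₄ a b x w s Real.pi) (frameN₃ a b x w s Real.pi)] at k1 k2 k3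
  refine ⟨?_, ?_, ?_⟩ <;> linarith

end IsProfile

namespace IsProfile

variable {a b : ℝ} {I : Set ℝ} {x w : ℝ → ℝ} (h : IsProfile a b I x w)

include h

lemma deriv_w_ne_zero {s : ℝ} (hs : s ∈ I) : deriv w s ≠ 0 := by
  intro h0
  have := h.unit s hs
  rw [h0] at this
  nlinarith [sq_nonneg (deriv x s)]

/-! ### Profile curves on a hyperbola -/

lemma mul_deriv_eq_of_hyperbola {K : ℝ} (hK : ∀ s ∈ I, x s ^ 2 - w s ^ 2 = K) {s : ℝ}
    (hs : s ∈ I) : x s * deriv x s = w s * deriv w s := by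
  have h1 : HasDerivAt (fun s => x s ^ 2 - w s ^ 2) 0 s :=
    (hasDerivAt_const s K).congr_of_eventuallyEq
      (by filter_upwards [h.mem_nhds hs] with σ hσ using hK σ hσ)
  have h2 := h1.unique (((h.hasDerivAt_x hs).pow 2).sub ((h.hasDerivAt_w hs).pow 2))
  simp only [Nat.cast_ofNat, Nat.add_one_sub_one, pow_one] at h2
  linear_combination -h2 / 2

/-- Position and velocity of the profile are orthogonal, so the position is a multiple ρ of the
normal (w', x'), with ρ² = K. Since w' never vanishes, the sign of ρ is constant on the interval. -/
lemma exists_eq_mul_deriv_of_hyperbola (hI : I.OrdConnected) {K : ℝ}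
    (hK : ∀ s ∈ I, x s ^ 2 - w s ^ 2 = K) :
    ∃ ρ : ℝ, ρ ≠ 0 ∧ ∀ s ∈ I, x s = ρ * deriv w s ∧ w s = ρ * deriv x s := by
  rcases I.eq_empty_or_nonempty with rfl | ⟨s₀, hs₀⟩
  · exact ⟨1, one_ne_zero, by simp⟩
  have hsq (s) (hs : s ∈ I) : x s ^ 2 = K * deriv w s ^ 2 := by
    rw [← hK s hs]
    linear_combination x s ^ 2 * h.unit s hs -
      (x s * deriv x s + w s * deriv w s) * h.mul_deriv_eq_of_hyperbola hK hs
  have hKpos : 0 < K := by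
    have hw' : 0 < deriv w s₀ ^ 2 := by have := h.deriv_w_ne_zero hs₀; positivity
    have h1 := hsq s₀ hs₀
    have h2 : 0 ≤ K := by
      by_contra! hneg
      nlinarith [sq_nonneg (x s₀)]
    -- K = 0 would give x = w = 0, where `∂ₜ r` degenerates.
    refine h2.lt_of_ne fun h0 => ?_
    have h3 := hK s₀ hs₀
    have h4 := h.pos s₀ hs₀
    rw [← h0, zero_mul] at h1
    rw [← h0, h1, zero_sub, neg_eq_zero] at h3
    simp [h1, h3] at h4
  have key : ∃ ρ : ℝ, ρ ≠ 0 ∧ ∀ s ∈ I, x s = ρ * deriv w s := by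
    have hK0 : Real.sqrt K ≠ 0 := (Real.sqrt_pos.2 hKpos).ne'
    rcases (hI.isPreconnected).eq_or_eq_neg_of_sq_eq h.contDiffOn_x.continuousOn
      (continuousOn_const.mul h.contDiffOn_deriv_w.continuousOn)
      (fun s hs => by simp [mul_pow, Real.sq_sqrt hKpos.le, hsq s hs])
      (fun {s} hs => mul_ne_zero hK0 (h.deriv_w_ne_zero hs)) with h1 | h1
    · exact ⟨_, hK0, fun s hs => h1 hs⟩
    · exact ⟨_, neg_ne_zero.2 hK0, fun s hs => (h1 hs).trans (by simp)⟩
  obtain ⟨ρ, hρ, hx⟩ := key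
  refine ⟨ρ, hρ, fun s hs => ⟨hx s hs, ?_⟩⟩
  have h1 := h.mul_deriv_eq_of_hyperbola hK hs
  rw [hx s hs] at h1
  exact mul_right_cancel₀ (h.deriv_w_ne_zero hs) (by linear_combination -h1)

section Hyperbola

variable {ρ : ℝ} (hρ : ρ ≠ 0) (hxw : ∀ s ∈ I, x s = ρ * deriv w s ∧ w s = ρ * deriv x s)

include hρ hxw

lemma curvProfile_of_hyperbola {s : ℝ} (hs : s ∈ I) : curvProfile x w s = 1 / ρ := by
  have h1 : HasDerivAt w (ρ * (curvProfile x w s * deriv w s)) s :=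
    ((h.hasDerivAt_deriv_x hs).const_mul ρ).congr_of_eventuallyEq
      (by filter_upwards [h.mem_nhds hs] with σ hσ using (hxw σ hσ).2)
  have h2 := h1.unique (h.hasDerivAt_w hs)
  have hw' := h.deriv_w_ne_zero hs
  rw [eq_div_iff hρ]
  exact mul_right_cancel₀ hw' (by linear_combination h2)

lemma curvOrbit_of_hyperbola {s : ℝ} (hs : s ∈ I) : curvOrbit a b x w s = -1 / ρ := by
  have hq := (h.pos s hs).ne'
  obtain ⟨h1, h2⟩ := hxw s hs
  rw [curvOrbit, div_eq_div_iff hq hρ]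
  linear_combination (a ^ 2 * x s) * h1 + (b ^ 2 * w s) * h2

omit h hρ in
lemma normalCoeff_of_hyperbola {s : ℝ} (hs : s ∈ I) : normalCoeff a b x w s = 0 := by
  obtain ⟨h1, h2⟩ := hxw s hs
  rw [normalCoeff, div_eq_zero_iff]
  left
  linear_combination a * b * (deriv x s * h1 - deriv w s * h2)

lemma deriv_curv_of_hyperbola {s : ℝ} (hs : s ∈ I) :
    deriv (curvProfile x w) s = deriv (curvOrbit a b x w) s := by
  have h1 : curvProfile x w =ᶠ[𝓝 s] fun _ => 1 / ρ := by
    filter_upwards [h.mem_nhds hs] with σ hσ using h.curvProfile_of_hyperbola hρ hxw hσ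
  have h2 : curvOrbit a b x w =ᶠ[𝓝 s] fun _ => -1 / ρ := by
    filter_upwards [h.mem_nhds hs] with σ hσ using h.curvOrbit_of_hyperbola hρ hxw hσ
  rw [h1.deriv_eq, h2.deriv_eq, deriv_const, deriv_const]

lemma torsion_mul_curv_of_hyperbola {s : ℝ} (hs : s ∈ I) :
    torsionCoeff a b x w s * (curvProfile x w s + curvOrbit a b x w s) = 0 := by
  rw [h.curvProfile_of_hyperbola hρ hxw hs, h.curvOrbit_of_hyperbola hρ hxw hs]
  ring

omit h hρ in
lemma curv_mul_normalCoeff_of_hyperbola {s : ℝ} (hs : s ∈ I) :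
    (curvOrbit a b x w s - curvProfile x w s) * normalCoeff a b x w s = 0 := by
  rw [normalCoeff_of_hyperbola hxw hs, mul_zero]

/-- The system x' = w/ρ, w' = x/ρ decouples in the null coordinates x ± w, which are multiples of
exp(±s/ρ). -/
lemma isOpenPart_of_hyperbola (hI : I.OrdConnected) (hne : I.Nonempty) : ∃ r₀ : ℝ, r₀ ≠ 0 ∧
    IsOpenPart (doubleRotational a b x w) (paramDomain I) (surfaceF a b r₀)
      (paramDomain Set.univ) := by
  obtain ⟨s₀, hs₀⟩ := hne
  have hexp (c s : ℝ) : HasDerivAt (fun s => Real.exp (c * s)) (Real.exp (c * s) * c) s := by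
    simpa using ((hasDerivAt_id s).const_mul c).exp
  have hadd (s) (hs : s ∈ I) : HasDerivAt (fun s => (x s + w s) * Real.exp (-(1 / ρ) * s)) 0 s := by
    obtain ⟨h1, h2⟩ := hxw s hs
    refine (((h.hasDerivAt_x hs).add (h.hasDerivAt_w hs)).mul (hexp (-(1 / ρ)) s)).congr_deriv ?_
    simp only [Pi.add_apply, h1, h2]
    field_simp
    ring
  have hsub (s) (hs : s ∈ I) : HasDerivAt (fun s => (x s - w s) * Real.exp (1 / ρ * s)) 0 s := by
    obtain ⟨h1, h2⟩ := hxw s hs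
    refine (((h.hasDerivAt_x hs).sub (h.hasDerivAt_w hs)).mul (hexp (1 / ρ) s)).congr_deriv ?_
    simp only [Pi.sub_apply, h1, h2]
    field_simp
    ring
  obtain ⟨α, hα⟩ := h.isOpen.exists_is_const_of_deriv_eq_zero hI.isPreconnected
    (fun s hs => (hadd s hs).differentiableAt.differentiableWithinAt) fun s hs => (hadd s hs).deriv
  obtain ⟨β, hβ⟩ := h.isOpen.exists_is_const_of_deriv_eq_zero hI.isPreconnected
    (fun s hs => (hsub s hs).differentiableAt.differentiableWithinAt) fun s hs => (hsub s hs).deriv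
  have hαβ : α * β = ρ ^ 2 := by
    obtain ⟨h1, h2⟩ := hxw s₀ hs₀
    rw [← hα s₀ hs₀, ← hβ s₀ hs₀, mul_mul_mul_comm, ← Real.exp_add, neg_mul, neg_add_cancel,
      Real.exp_zero, h1, h2]
    linear_combination (-ρ ^ 2) * h.unit s₀ hs₀
  have hα0 : α ≠ 0 := by
    rintro rfl
    rw [zero_mul] at hαβ
    exact pow_ne_zero 2 hρ hαβ.symm
  -- ε is the sign of α/ρ and τ the logarithm of its absolute value; αβ = ρ² then determines β.
  obtain ⟨ε, hε, τ, hτ⟩ : ∃ ε : ℝ, ε ^ 2 = 1 ∧ ∃ τ : ℝ, α = ε * ρ * Real.exp τ := by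
    rcases lt_or_gt_of_ne (div_ne_zero hα0 hρ) with hneg | hpos
    · refine ⟨-1, by norm_num, Real.log (-(α / ρ)), ?_⟩
      rw [Real.exp_log (neg_pos.2 hneg)]
      field_simp
    · refine ⟨1, by norm_num, Real.log (α / ρ), ?_⟩
      rw [Real.exp_log hpos]
      field_simp
  have hε0 : ε ≠ 0 := by rintro rfl; norm_num at hε
  have hτ' : β = ε * ρ * Real.exp (-τ) := by
    refine mul_left_cancel₀ hα0 ?_
    rw [hαβ, hτ, Real.exp_neg]
    field_simp
    linear_combination -hε
  have hplus (s) (hs : s ∈ I) : x s + w s = ε * ρ * Real.exp (s / ρ + τ) := by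
    rw [Real.exp_add, mul_comm (Real.exp _), ← mul_assoc, ← hτ, ← hα s hs, mul_assoc,
      ← Real.exp_add, ← mul_one (x s + w s)]
    congr 1
    · ring
    · rw [eq_comm, Real.exp_eq_one_iff]
      ring
  have hminus (s) (hs : s ∈ I) : x s - w s = ε * ρ * Real.exp (-(s / ρ + τ)) := by
    rw [neg_add, Real.exp_add, mul_comm (Real.exp _), ← mul_assoc, ← hτ', ← hβ s hs, mul_assoc,
      ← Real.exp_add, ← mul_one (x s - w s)]
    congr 1
    · ring
    · rw [eq_comm, Real.exp_eq_one_iff]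
      ring
  have harg (s : ℝ) : (ε * s + ε * ρ * τ) / (ε * ρ) = s / ρ + τ := by
    field_simp
  -- With r₀ = ερ, the reparametrization must send s/ρ + τ to s/r₀; as ε = ±1, it is its own inverse
  -- up to the shift.
  refine ⟨ε * ρ, mul_ne_zero hε0 hρ, fun p => (ε * p.1 + ε * ρ * τ, p.2),
    fun p => (ε * (p.1 - ε * ρ * τ), p.2), ?_, ?_, ?_, ?_, ?_, ?_⟩
  · have himage : (fun p : ℝ × ℝ => (ε * p.1 + ε * ρ * τ, p.2)) '' paramDomain I =
        (fun p : ℝ × ℝ => (ε * (p.1 - ε * ρ * τ), p.2)) ⁻¹' paramDomain I := by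
      refine congrFun (Set.image_eq_preimage_of_inverse (fun p => ?_) (fun p => ?_)) _
      · ext
        · simp only
          linear_combination p.1 * hε
        · rfl
      · ext
        · simp only
          linear_combination (p.1 - ε * ρ * τ) * hε
        · rfl
    rw [himage]
    exact (isOpen_paramDomain h.isOpen).preimage (by fun_prop)
  · rintro - ⟨p, hp, rfl⟩
    exact ⟨Set.mem_univ _, hp.2⟩
  · exact ContDiff.contDiffOn (by fun_prop)
  · exact ContDiff.contDiffOn (by fun_prop)
  · intro p _
    ext
    · simp only
      linear_combination p.1 * hε
    · rfl
  · intro p hp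
    have h1 : x p.1 = ε * ρ * Real.cosh (p.1 / ρ + τ) := by
      rw [Real.cosh_eq]
      linear_combination (hplus _ hp.1 + hminus _ hp.1) / 2
    have h2 : w p.1 = ε * ρ * Real.sinh (p.1 / ρ + τ) := by
      rw [Real.sinh_eq]
      linear_combination (hplus _ hp.1 - hminus _ hp.1) / 2
    simp only [surfaceF, doubleRotational, harg, h1, h2]

end Hyperbola

end IsProfile

namespace IsProfile

variable {a b : ℝ} {I : Set ℝ} {x w : ℝ → ℝ} (h : IsProfile a b I x w)

include h

/-! ### Surfaces in a timelike plane -/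

/-- Where κ ≠ 0, ω vanishes on a neighbourhood, and the Codazzi equation ω' = κη - 2λω gives η = 0.
Then ω = η = 0 is a nondegenerate linear system for (x, w), which forces x = w = 0. -/
lemma curvProfile_eq_zero_of_torsion_mul (ha : a ≠ 0) (hb : b ≠ 0)
    (h1 : ∀ s ∈ I, torsionCoeff a b x w s * curvProfile x w s = 0) {s : ℝ} (hs : s ∈ I) :
    curvProfile x w s = 0 := by
  by_contra hκ
  have hω : torsionCoeff a b x w =ᶠ[𝓝 s] fun _ => 0 := by
    filter_upwards [h.mem_nhds hs, (h.hasDerivAt_curvProfile hs).continuousAt.eventually_ne hκ]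
      with σ hσ hσκ
    exact (mul_eq_zero.1 (h1 σ hσ)).resolve_right hσκ
  have hω0 : torsionCoeff a b x w s = 0 := hω.self_of_nhds
  have hη := (h.hasDerivAt_torsionCoeff hs).deriv
  rw [hω.deriv_eq, deriv_const, hω0, mul_zero, sub_zero, eq_comm, mul_eq_zero,
    or_iff_right hκ] at hη
  have hpos := h.pos s hs
  rw [torsionCoeff, div_eq_zero_iff, or_iff_left hpos.ne', mul_eq_zero,
    or_iff_right (mul_ne_zero ha hb)] at hω0
  rw [normalCoeff, div_eq_zero_iff, or_iff_left hpos.ne', mul_eq_zero,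
    or_iff_right (mul_ne_zero ha hb)] at hη
  have hu := h.unit s hs
  have hx : x s = 0 := by
    linear_combination x s * hu + (-deriv x s) * hη + deriv w s * hω0
  have hw : w s = 0 := by
    linear_combination w s * hu + deriv x s * hω0 - deriv w s * hη
  simp [hx, hw] at hpos

lemma exists_affine_of_curv_eq_zero (ha : a ≠ 0) (hI : I.OrdConnected)
    (h1 : ∀ s ∈ I, curvProfile x w s = 0) (h2 : ∀ s ∈ I, curvOrbit a b x w s = 0) :
    ∃ γ δ : ℝ, γ ^ 2 = 1 ∧ ∀ s ∈ I, x s = 0 ∧ w s = γ * s + δ := by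
  rcases I.eq_empty_or_nonempty with rfl | ⟨s₀, hs₀⟩
  · exact ⟨1, 0, by norm_num, by simp⟩
  have hx' (s) (hs : s ∈ I) : HasDerivAt (deriv x) 0 s := by
    simpa [h1 s hs] using h.hasDerivAt_deriv_x hs
  have hw' (s) (hs : s ∈ I) : HasDerivAt (deriv w) 0 s := by
    simpa [h1 s hs] using h.hasDerivAt_deriv_w hs
  obtain ⟨γ, hγ⟩ := h.isOpen.exists_is_const_of_deriv_eq_zero hI.isPreconnected
    (fun s hs => (hw' s hs).differentiableAt.differentiableWithinAt) fun s hs => (hw' s hs).deriv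
  have hnum (s) (hs : s ∈ I) : a ^ 2 * x s * deriv w s + b ^ 2 * w s * deriv x s = 0 := by
    have := h2 s hs
    rwa [curvOrbit, div_eq_zero_iff, or_iff_left (h.pos s hs).ne', neg_eq_zero] at this
  -- With x' and w' locally constant, differentiating a²xw' + b²wx' = 0 gives (a² + b²)x'w' = 0.
  have hx0' (s) (hs : s ∈ I) : deriv x s = 0 := by
    have e1 : HasDerivAt (fun s => a ^ 2 * x s * deriv w s + b ^ 2 * w s * deriv x s) 0 s :=
      (hasDerivAt_const s (0 : ℝ)).congr_of_eventuallyEq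
        (by filter_upwards [h.mem_nhds hs] with σ hσ using hnum σ hσ)
    have e2 := e1.unique ((((h.hasDerivAt_x hs).const_mul (a ^ 2)).mul (hw' s hs)).add
      (((h.hasDerivAt_w hs).const_mul (b ^ 2)).mul (hx' s hs)))
    have e3 : (a ^ 2 + b ^ 2) * deriv w s * deriv x s = 0 := by linear_combination -e2
    refine (mul_eq_zero.1 e3).resolve_left (mul_ne_zero ?_ (h.deriv_w_ne_zero hs))
    positivity
  have hx0 (s) (hs : s ∈ I) : x s = 0 := by
    have := hnum s hs
    rw [hx0' s hs, mul_zero, add_zero] at this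
    simpa [ha, h.deriv_w_ne_zero hs] using this
  have hlin (s) (hs : s ∈ I) : HasDerivAt (fun s => w s - γ * s) 0 s := by
    refine ((h.hasDerivAt_w hs).sub ((hasDerivAt_id s).const_mul γ)).congr_deriv ?_
    rw [hγ s hs]
    ring
  obtain ⟨δ, hδ⟩ := h.isOpen.exists_is_const_of_deriv_eq_zero hI.isPreconnected
    (fun s hs => (hlin s hs).differentiableAt.differentiableWithinAt) fun s hs => (hlin s hs).deriv
  refine ⟨γ, δ, ?_, fun s hs => ⟨hx0 s hs, ?_⟩⟩
  · have := h.unit s₀ hs₀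
    rw [hx0' s₀ hs₀, hγ s₀ hs₀] at this
    linear_combination -this
  · linear_combination hδ s hs

/-- The parametrization is by hyperbolic polar coordinates in the x₃x₄-plane, with radius w and
angle bt. They are inverted by a square root and logarithms of null coordinates. -/
lemma isOpenPartOfTimelikePlane_of_affine (hb : b ≠ 0) (hI : I.OrdConnected) {γ δ : ℝ}
    (hγ : γ ^ 2 = 1) (hxw : ∀ s ∈ I, x s = 0 ∧ w s = γ * s + δ) :
    IsOpenPartOfTimelikePlane (doubleRotational a b x w) (paramDomain I) := by
  have hw0 (s) (hs : s ∈ I) : w s ≠ 0 := by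
    intro h0
    have := h.pos s hs
    simp [h0, (hxw s hs).1] at this
  -- w has no zero, so its sign σ is constant; it selects the quadrant W on which the polar
  -- coordinates are inverted.
  obtain ⟨σ, hσ, hsign⟩ : ∃ σ : ℝ, σ ^ 2 = 1 ∧ ∀ s ∈ I, 0 < σ * w s := by
    rcases hI.isPreconnected.eq_or_eq_neg_of_sq_eq h.contDiffOn_w.continuousOn
      h.contDiffOn_w.continuousOn.abs (fun s _ => by simp)
      (fun {s} hs => abs_ne_zero.2 (hw0 s hs)) with h1 | h1
    · refine ⟨1, by norm_num, fun s hs => ?_⟩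
      rw [one_mul, h1 hs]
      exact abs_pos.2 (hw0 s hs)
    · refine ⟨-1, by norm_num, fun s hs => ?_⟩
      rw [h1 hs]
      simpa using hw0 s hs
  have hσ0 : σ ≠ 0 := by rintro rfl; norm_num at hσ
  set φ : ℝ × ℝ → ℝ × ℝ := fun p =>
    ((γ * p.1 + δ) * Real.cosh (b * p.2), (γ * p.1 + δ) * Real.sinh (b * p.2)) with hφ
  set ψ : ℝ × ℝ → ℝ × ℝ := fun q =>
    (γ * (σ * Real.sqrt (q.1 ^ 2 - q.2 ^ 2) - δ),
      (Real.log (q.1 + q.2) - Real.log (q.1 - q.2)) / (2 * b)) with hψ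
  set W : Set (ℝ × ℝ) := {q | 0 < σ * (q.1 + q.2)} ∩ {q | 0 < σ * (q.1 - q.2)} with hW
  have hadd (p : ℝ × ℝ) : (φ p).1 + (φ p).2 = (γ * p.1 + δ) * Real.exp (b * p.2) := by
    rw [← Real.cosh_add_sinh]
    ring
  have hsub (p : ℝ × ℝ) : (φ p).1 - (φ p).2 = (γ * p.1 + δ) * Real.exp (-(b * p.2)) := by
    rw [← Real.cosh_sub_sinh]
    ring
  have hφW : φ '' paramDomain I ⊆ W := by
    rintro - ⟨p, hp, rfl⟩
    have hpos := hsign p.1 hp.1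
    rw [(hxw _ hp.1).2] at hpos
    constructor
    · change 0 < σ * ((φ p).1 + (φ p).2)
      rw [hadd, ← mul_assoc]
      positivity
    · change 0 < σ * ((φ p).1 - (φ p).2)
      rw [hsub, ← mul_assoc]
      positivity
  have hleft (p) (hp : p ∈ paramDomain I) : ψ (φ p) = p := by
    have hpos := hsign p.1 hp.1
    rw [(hxw _ hp.1).2] at hpos
    have hne : γ * p.1 + δ ≠ 0 := by
      intro h0
      simp [h0] at hpos
    ext
    · have hsq : (φ p).1 ^ 2 - (φ p).2 ^ 2 = (σ * (γ * p.1 + δ)) ^ 2 := by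
        simp only [hφ]
        linear_combination (γ * p.1 + δ) ^ 2 * Real.cosh_sq_sub_sinh_sq (b * p.2)
          - (γ * p.1 + δ) ^ 2 * hσ
      simp only [hψ]
      rw [hsq, Real.sqrt_sq hpos.le]
      linear_combination γ * (γ * p.1 + δ) * hσ + p.1 * hγ
    · simp only [hψ]
      rw [hadd, hsub, Real.log_mul hne (Real.exp_ne_zero _), Real.log_mul hne (Real.exp_ne_zero _),
        Real.log_exp, Real.log_exp]
      field_simp
      ring
  have hright (q) (hq : q ∈ W) : φ (ψ q) = q := by
    obtain ⟨m, hm⟩ : ∃ m, q.1 + q.2 = σ * Real.exp m := by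
      refine ⟨Real.log (σ * (q.1 + q.2)), ?_⟩
      rw [Real.exp_log hq.1]
      linear_combination (-(q.1 + q.2)) * hσ
    obtain ⟨n, hn⟩ : ∃ n, q.1 - q.2 = σ * Real.exp n := by
      refine ⟨Real.log (σ * (q.1 - q.2)), ?_⟩
      rw [Real.exp_log hq.2]
      linear_combination (-(q.1 - q.2)) * hσ
    have hsqrt : Real.sqrt (q.1 ^ 2 - q.2 ^ 2) = Real.exp ((m + n) / 2) := by
      rw [show q.1 ^ 2 - q.2 ^ 2 = Real.exp ((m + n) / 2) ^ 2 by
        rw [← Real.exp_nat_mul, Nat.cast_ofNat, mul_div_cancel₀ _ two_ne_zero, Real.exp_add]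
        linear_combination (q.1 - q.2) * hm + σ * Real.exp m * hn
          + Real.exp m * Real.exp n * hσ]
      exact Real.sqrt_sq (Real.exp_pos _).le
    have hlog : b * (ψ q).2 = (m - n) / 2 := by
      simp only [hψ]
      rw [hm, hn, Real.log_mul hσ0 (Real.exp_ne_zero _), Real.log_mul hσ0 (Real.exp_ne_zero _),
        Real.log_exp, Real.log_exp]
      field_simp
      ring
    have hfst : γ * (ψ q).1 + δ = σ * Real.exp ((m + n) / 2) := by
      simp only [hψ]
      rw [hsqrt]
      linear_combination (σ * Real.exp ((m + n) / 2) - δ) * hγ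
    have e1 : (φ (ψ q)).1 + (φ (ψ q)).2 = q.1 + q.2 := by
      rw [hadd, hfst, hlog, hm, mul_assoc, ← Real.exp_add]
      ring_nf
    have e2 : (φ (ψ q)).1 - (φ (ψ q)).2 = q.1 - q.2 := by
      rw [hsub, hfst, hlog, hn, mul_assoc, ← Real.exp_add]
      ring_nf
    ext
    · linear_combination (e1 + e2) / 2
    · linear_combination (e1 - e2) / 2
  have hWopen : IsOpen W :=
    (isOpen_lt continuous_const (by fun_prop)).inter (isOpen_lt continuous_const (by fun_prop))
  have hψsmooth : ContDiffOn ℝ ∞ ψ W := by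
    intro q hq
    have h1 : q.1 + q.2 ≠ 0 := fun h0 => by
      have := hq.1
      simp [h0] at this
    have h2 : q.1 - q.2 ≠ 0 := fun h0 => by
      have := hq.2
      simp [h0] at this
    have h3 : q.1 ^ 2 - q.2 ^ 2 ≠ 0 := by
      rw [sq_sub_sq]
      exact mul_ne_zero h1 h2
    have d1 : ContDiffAt ℝ ∞ (fun q : ℝ × ℝ => Real.sqrt (q.1 ^ 2 - q.2 ^ 2)) q :=
      ContDiffAt.sqrt (by fun_prop) h3
    have d2 : ContDiffAt ℝ ∞ (fun q : ℝ × ℝ => Real.log (q.1 + q.2)) q :=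
      ContDiffAt.log (by fun_prop) h1
    have d3 : ContDiffAt ℝ ∞ (fun q : ℝ × ℝ => Real.log (q.1 - q.2)) q :=
      ContDiffAt.log (by fun_prop) h2
    exact ((contDiffAt_const.mul ((contDiffAt_const.mul d1).sub contDiffAt_const)).prodMk
      ((d2.sub d3).div_const _)).contDiffWithinAt
  refine ⟨0, ![0, 0, 0, 1], ![0, 0, 1, 0], by simp [mink], by simp [mink], by simp [mink],
    φ, ψ, ?_, Set.subset_univ _, ?_, hψsmooth.mono hφW, hleft, ?_⟩
  -- Since ψ inverts φ on both sides, the image is a preimage under a continuous map, hence open.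
  · have himage : φ '' paramDomain I = W ∩ ψ ⁻¹' paramDomain I := by
      ext q
      constructor
      · intro hq
        refine ⟨hφW hq, ?_⟩
        obtain ⟨p, hp, rfl⟩ := hq
        rwa [Set.mem_preimage, hleft p hp]
      · rintro ⟨hqW, hq⟩
        exact ⟨ψ q, hq, hright q hqW⟩
    rw [himage]
    exact hψsmooth.continuousOn.isOpen_inter_preimage hWopen (isOpen_paramDomain h.isOpen)
  · refine ContDiff.contDiffOn ?_
    have hb' : ContDiff ℝ ∞ fun p : ℝ × ℝ => b * p.2 := by fun_prop
    have hl : ContDiff ℝ ∞ fun p : ℝ × ℝ => γ * p.1 + δ := by fun_prop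
    exact (hl.mul hb'.cosh).prodMk (hl.mul hb'.sinh)
  · intro p hp
    ext i
    fin_cases i <;> simp [doubleRotational, planeMap, hφ, hxw _ hp.1]

omit h in
lemma map_eq_zero_of_hasDerivAt {V W : Type*} [NormedAddCommGroup V] [NormedSpace ℝ V]
    [NormedAddCommGroup W] [NormedSpace ℝ W] (L : V →L[ℝ] W) {f : ℝ → V} {f' : V} {τ : ℝ} {c : W}
    (hf : HasDerivAt f f' τ) (hc : ∀ᶠ σ in 𝓝 τ, L (f σ) = c) : L f' = 0 :=
  (L.hasFDerivAt.comp_hasDerivAt τ hf).unique ((hasDerivAt_const τ c).congr_of_eventuallyEq hc)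

omit h in
/-- A vector orthogonal to two orthonormal vectors of a Lorentzian plane is not a unit vector of
that plane. -/
lemma mink_self_eq_zero_of_mem_plane {X Y S T N : E41} (hX : mink X X = -1) (hY : mink Y Y = 1)
    (hXY : mink X Y = 0) (hS : mink S S = -1) (hT : mink T T = 1) (hST : mink S T = 0)
    (hSN : mink S N = 0) (hTN : mink T N = 0) {p₁ q₁ p₂ q₂ p₃ q₃ : ℝ}
    (eS : S = p₁ • X + q₁ • Y) (eT : T = p₂ • X + q₂ • Y) (eN : N = p₃ • X + q₃ • Y) :
    mink N N = 0 := by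
  subst eS eT eN
  simp only [mink_add_left, mink_add_right, mink_smul_left, mink_smul_right, hX, hY, hXY,
    mink_comm Y X] at hS hT hST hSN hTN ⊢
  have hdet : (p₁ * q₂ - p₂ * q₁) ^ 2 = 1 := by
    linear_combination (p₂ ^ 2 - q₂ ^ 2) * hS + hT + (q₁ * q₂ - p₁ * p₂) * hST
  have hdet0 : p₁ * q₂ - p₂ * q₁ ≠ 0 := fun h0 => by
    rw [h0] at hdet
    norm_num at hdet
  have hp₃ : p₃ = 0 := by
    refine (mul_eq_zero.1 ?_).resolve_left hdet0
    linear_combination q₁ * hTN - q₂ * hSN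
  have hq₃ : q₃ = 0 := by
    refine (mul_eq_zero.1 ?_).resolve_left hdet0
    linear_combination p₁ * hTN - p₂ * hSN
  rw [hp₃, hq₃]
  ring

/-- S and T stay in the direction plane, hence so do their derivatives, while N₃ and N₄ lie outside
it; the normal components κ, μ, ω of those derivatives must vanish. -/
lemma coeffs_eq_zero_of_isOpenPartOfTimelikePlane
    (hM : IsOpenPartOfTimelikePlane (doubleRotational a b x w) (paramDomain I)) {s : ℝ}
    (hs : s ∈ I) :
    curvProfile x w s = 0 ∧ curvOrbit a b x w s = 0 ∧ torsionCoeff a b x w s = 0 := by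
  obtain ⟨c, X, Y, hX, hY, hXY, φ, -, -, -, -, -, -, hr⟩ := hM
  -- Orthogonal projection along the direction plane; the plus sign reflects ⟨X, X⟩ = -1.
  let L : E41 →L[ℝ] E41 := LinearMap.toContinuousLinearMap
    { toFun := fun v => v + mink v X • X - mink v Y • Y
      map_add' := fun u v => by simp only [mink_add_left]; module
      map_smul' := fun k u => by simp only [mink_smul_left, RingHom.id_apply]; module }
  have hL (v : E41) : L v = v + mink v X • X - mink v Y • Y := rfl
  have hLX : L X = 0 := by rw [hL, hX, hXY]; module
  have hLY : L Y = 0 := by rw [hL, mink_comm Y X, hXY, hY]; module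
  have hker (v : E41) (hv : L v = 0) : v = (-mink v X) • X + mink v Y • Y := by
    rw [hL] at hv
    rw [← sub_eq_zero, ← hv]
    module
  have hmem (s t : ℝ) (hs : s ∈ I) (ht : t ∈ Set.Ioo 0 (2 * Real.pi)) :
      L (doubleRotational a b x w (s, t)) = L c := by
    rw [hr (s, t) ⟨hs, ht⟩, planeMap]
    simp [hLX, hLY]
  have hLS (s t : ℝ) (hs : s ∈ I) (ht : t ∈ Set.Ioo 0 (2 * Real.pi)) :
      L (frameS a b x w s t) = 0 := by
    refine map_eq_zero_of_hasDerivAt L (f := fun s => doubleRotational a b x w (s, t)) ?_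
      (by filter_upwards [h.mem_nhds hs] with σ hσ using hmem σ t hσ ht)
    simp only [doubleRotational_eq]
    exact hasDerivAt_rotVec_coeff a b t (h.hasDerivAt_x hs) (hasDerivAt_const _ _)
      (hasDerivAt_const _ _) (h.hasDerivAt_w hs)
  have hLT (s t : ℝ) (hs : s ∈ I) (ht : t ∈ Set.Ioo 0 (2 * Real.pi)) :
      L (frameT a b x w s t) = 0 := by
    have hG := (h.speed_pos hs).ne'
    have hd : HasDerivAt (fun t => doubleRotational a b x w (s, t))
        (speed a b x w s • frameT a b x w s t) t := by
      simp only [doubleRotational_eq]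
      refine (hasDerivAt_rotVec_angle a b t _ _ _ _).congr_deriv ?_
      rw [frameT, smul_rotVec]
      congr 1 <;> field_simp <;> ring
    have := map_eq_zero_of_hasDerivAt L hd
      (by filter_upwards [Ioo_mem_nhds ht.1 ht.2] with τ hτ using hmem s τ hs hτ)
    rwa [map_smul, smul_eq_zero, or_iff_right hG] at this
  have ht : Real.pi ∈ Set.Ioo 0 (2 * Real.pi) := ⟨Real.pi_pos, by linarith [Real.pi_pos]⟩
  have hG := (h.speed_pos hs).ne'
  have hnormal (N : E41) (hN : mink N N = 1) (hSN : mink (frameS a b x w s Real.pi) N = 0)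
      (hTN : mink (frameT a b x w s Real.pi) N = 0) (k : ℝ) (hk : L (k • N) = 0) : k = 0 := by
    rw [map_smul, smul_eq_zero] at hk
    refine hk.resolve_right fun hLN => ?_
    have := mink_self_eq_zero_of_mem_plane hX hY hXY (h.mink_frameS_frameS hs _)
      (h.mink_frameT_frameT hs _) (mink_frameS_frameT _) hSN hTN (hker _ (hLS s _ hs ht))
      (hker _ (hLT s _ hs ht)) (hker _ hLN)
    rw [hN] at this
    exact one_ne_zero this
  refine ⟨?_, ?_, ?_⟩
  · exact hnormal _ (h.mink_frameN₃_frameN₃ hs _) (mink_frameS_frameN₃ _) (mink_frameT_frameN₃ _) _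
      (map_eq_zero_of_hasDerivAt L (h.hasDerivAt_frameS hs Real.pi)
        (by filter_upwards [h.mem_nhds hs] with σ hσ using hLS σ _ hσ ht))
  · have := map_eq_zero_of_hasDerivAt L (h.hasDerivAt_frameT_angle hs Real.pi)
      (by filter_upwards [Ioo_mem_nhds ht.1 ht.2] with τ hτ using hLT s τ hs hτ)
    rw [map_add, map_smul L _ (frameS a b x w s Real.pi), hLS s _ hs ht, smul_zero, add_zero]
      at this
    exact (mul_eq_zero.1 (hnormal _ (h.mink_frameN₃_frameN₃ hs _) (mink_frameS_frameN₃ _)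
      (mink_frameT_frameN₃ _) _ this)).resolve_left hG
  · have := map_eq_zero_of_hasDerivAt L (h.hasDerivAt_frameS_angle hs Real.pi)
      (by filter_upwards [Ioo_mem_nhds ht.1 ht.2] with τ hτ using hLS s τ hs hτ)
    rw [map_add, map_smul L _ (frameT a b x w s Real.pi), hLT s _ hs ht, smul_zero, zero_add]
      at this
    exact (mul_eq_zero.1 (hnormal _ (h.mink_frameN₄_frameN₄ hs _) (mink_frameS_frameN₄ _)
      (mink_frameT_frameN₄ _) _ this)).resolve_left hG

/-! ### Classification -/

lemma isOpenPart_of_hasPointwiseOneTypeFirstKind (ha : a ≠ 0) (hb : b ≠ 0) (hI : I.OrdConnected)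
    (hne : I.Nonempty)
    (hM : HasPointwiseOneTypeFirstKind (doubleRotational a b x w) (paramDomain I)) :
    IsOpenPartOfTimelikePlane (doubleRotational a b x w) (paramDomain I) ∨
      ∃ r₀ : ℝ, r₀ ≠ 0 ∧ IsOpenPart (doubleRotational a b x w) (paramDomain I)
        (surfaceF a b r₀) (paramDomain Set.univ) := by
  have heq {s : ℝ} (hs : s ∈ I) := h.equations_of_hasPointwiseOneTypeFirstKind hM hs
  have hdiff (s) (hs : s ∈ I) :
      HasDerivAt (fun s => curvOrbit a b x w s - curvProfile x w s) 0 s := by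
    refine ((h.hasDerivAt_curvOrbit hs).sub (h.hasDerivAt_curvProfile hs)).congr_deriv ?_
    rw [(heq hs).1, ← (h.hasDerivAt_curvOrbit hs).deriv, sub_self]
  obtain ⟨c, hc⟩ := h.isOpen.exists_is_const_of_deriv_eq_zero hI.isPreconnected
    (fun s hs => (hdiff s hs).differentiableAt.differentiableWithinAt)
    fun s hs => (hdiff s hs).deriv
  -- c/2 is the component of the mean curvature vector along N₃: the minimal case gives planes, the
  -- other gives hyperbolas.
  rcases eq_or_ne c 0 with rfl | hc0
  · left
    have hκ (s) (hs : s ∈ I) : curvProfile x w s = 0 := by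
      refine h.curvProfile_eq_zero_of_torsion_mul ha hb (fun s hs => ?_) hs
      linear_combination (heq hs).2.1 / 2 - torsionCoeff a b x w s / 2 * hc s hs
    have hμ (s) (hs : s ∈ I) : curvOrbit a b x w s = 0 := by
      linear_combination hc s hs + hκ s hs
    obtain ⟨γ, δ, hγ, hxw⟩ := h.exists_affine_of_curv_eq_zero ha hI hκ hμ
    exact h.isOpenPartOfTimelikePlane_of_affine hb hI hγ hxw
  · right
    have hη (s) (hs : s ∈ I) : x s * deriv x s = w s * deriv w s := by
      have := (heq hs).2.2
      rw [hc s hs, mul_eq_zero, or_iff_right hc0, normalCoeff, div_eq_zero_iff,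
        or_iff_left (h.pos s hs).ne', mul_eq_zero, or_iff_right (mul_ne_zero ha hb)] at this
      exact sub_eq_zero.1 this
    have hK (s) (hs : s ∈ I) : HasDerivAt (fun s => x s ^ 2 - w s ^ 2) 0 s := by
      refine (((h.hasDerivAt_x hs).pow 2).sub ((h.hasDerivAt_w hs).pow 2)).congr_deriv ?_
      simp only [Nat.cast_ofNat, Nat.add_one_sub_one, pow_one]
      linear_combination 2 * hη s hs
    obtain ⟨K, hK⟩ := h.isOpen.exists_is_const_of_deriv_eq_zero hI.isPreconnected
      (fun s hs => (hK s hs).differentiableAt.differentiableWithinAt) fun s hs => (hK s hs).deriv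
    obtain ⟨ρ, hρ, hxw⟩ := h.exists_eq_mul_deriv_of_hyperbola hI hK
    exact h.isOpenPart_of_hyperbola hρ hxw hI hne

lemma hasPointwiseOneTypeFirstKind_of_plane
    (hM : IsOpenPartOfTimelikePlane (doubleRotational a b x w) (paramDomain I)) :
    HasPointwiseOneTypeFirstKind (doubleRotational a b x w) (paramDomain I) := by
  have hz {s : ℝ} (hs : s ∈ I) := h.coeffs_eq_zero_of_isOpenPartOfTimelikePlane hM hs
  refine h.hasPointwiseOneTypeFirstKind (fun s hs => ?_) (fun s hs => ?_) (fun s hs => ?_)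
  · have e1 : curvProfile x w =ᶠ[𝓝 s] fun _ => 0 := by
      filter_upwards [h.mem_nhds hs] with σ hσ using (hz hσ).1
    have e2 : curvOrbit a b x w =ᶠ[𝓝 s] fun _ => 0 := by
      filter_upwards [h.mem_nhds hs] with σ hσ using (hz hσ).2.1
    rw [e1.deriv_eq, e2.deriv_eq]
  · rw [(hz hs).2.2, zero_mul]
  · rw [(hz hs).1, (hz hs).2.1, sub_zero, zero_mul]

lemma hasPointwiseOneTypeFirstKind_of_surfaceF (hI : I.OrdConnected) {r₀ : ℝ}
    (hM : IsOpenPart (doubleRotational a b x w) (paramDomain I) (surfaceF a b r₀)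
      (paramDomain Set.univ)) :
    HasPointwiseOneTypeFirstKind (doubleRotational a b x w) (paramDomain I) := by
  obtain ⟨φ, -, -, -, -, -, -, hr⟩ := hM
  -- Every point of F has position vector of square r₀², whatever the reparametrization, and that
  -- square is x² - w² on the given surface.
  have hK (s) (hs : s ∈ I) : x s ^ 2 - w s ^ 2 = r₀ ^ 2 := by
    have h1 := hr (s, Real.pi) ⟨hs, Real.pi_pos, by linarith [Real.pi_pos]⟩
    have h2 := congrArg (fun v => mink v v) h1
    simp only [surfaceF, doubleRotational_eq, mink_rotVec] at h2
    linear_combination h2 + r₀ ^ 2 * Real.cosh_sq_sub_sinh_sq ((φ (s, Real.pi)).1 / r₀)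
  obtain ⟨ρ, hρ, hxw⟩ := h.exists_eq_mul_deriv_of_hyperbola hI hK
  exact h.hasPointwiseOneTypeFirstKind (fun s hs => h.deriv_curv_of_hyperbola hρ hxw hs)
    (fun s hs => h.torsion_mul_curv_of_hyperbola hρ hxw hs)
    (fun s hs => curv_mul_normalCoeff_of_hyperbola hxw hs)

end IsProfile

/-! ### Timelike surfaces as profiles, and the model surface F -/

lemma isProfile_of_isTimelikeOn {a b : ℝ} {I : Set ℝ} {x w : ℝ → ℝ} (hI : IsOpen I)
    (hx : ContDiffOn ℝ ∞ x I) (hw : ContDiffOn ℝ ∞ w I)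
    (hu : ∀ s ∈ I, deriv x s ^ 2 - deriv w s ^ 2 = -1)
    (hM : IsTimelikeOn (doubleRotational a b x w) (paramDomain I)) : IsProfile a b I x w := by
  refine ⟨hI, hx, hw, hu, fun s hs => ?_⟩
  have hdet := hM (s, Real.pi) ⟨hs, Real.pi_pos, by linarith [Real.pi_pos]⟩
  have hxd : HasDerivAt x (deriv x s) s :=
    ((hx.differentiableOn (by simp)).differentiableAt (hI.mem_nhds hs)).hasDerivAt
  have hwd : HasDerivAt w (deriv w s) s :=
    ((hw.differentiableOn (by simp)).differentiableAt (hI.mem_nhds hs)).hasDerivAt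
  have e0 : pd 0 (doubleRotational a b x w) (s, Real.pi) =
      rotVec a b Real.pi (deriv x s) 0 0 (deriv w s) := by
    refine pd_zero_eq ?_
    simp only [doubleRotational_eq]
    exact hasDerivAt_rotVec_coeff a b _ hxd (hasDerivAt_const _ _) (hasDerivAt_const _ _) hwd
  have e1 : pd 1 (doubleRotational a b x w) (s, Real.pi) =
      rotVec a b Real.pi (-a * 0) (a * x s) (b * w s) (b * 0) := by
    refine pd_one_eq ?_
    simp only [doubleRotational_eq]
    exact hasDerivAt_rotVec_angle a b Real.pi _ _ _ _
  rw [Matrix.det_fin_two] at hdet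
  simp only [firstForm, Matrix.of_apply, e0, e1, mink_rotVec] at hdet
  -- The determinant of the metric is (x'² - w'²)(a²x² + b²w²), and the first factor is -1.
  linear_combination hdet - (a ^ 2 * x s ^ 2 + b ^ 2 * w s ^ 2) * hu s hs

section SurfaceF

variable (a b : ℝ) {r₀ : ℝ} (hr₀ : r₀ ≠ 0)

include hr₀

lemma deriv_cosh_profile : deriv (fun s => r₀ * Real.cosh (s / r₀)) =
    fun s => Real.sinh (s / r₀) := by
  ext s
  refine ((((hasDerivAt_id s).div_const r₀).cosh.const_mul r₀).congr_deriv ?_).deriv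
  simp only [id]
  field_simp

lemma deriv_sinh_profile : deriv (fun s => r₀ * Real.sinh (s / r₀)) =
    fun s => Real.cosh (s / r₀) := by
  ext s
  refine ((((hasDerivAt_id s).div_const r₀).sinh.const_mul r₀).congr_deriv ?_).deriv
  simp only [id]
  field_simp

lemma isProfile_surfaceF (ha : a ≠ 0) : IsProfile a b Set.univ
    (fun s => r₀ * Real.cosh (s / r₀)) (fun s => r₀ * Real.sinh (s / r₀)) := by
  have hdiv : ContDiff ℝ ∞ fun s : ℝ => s / r₀ := by fun_prop
  refine ⟨isOpen_univ, (contDiff_const.mul hdiv.cosh).contDiffOn,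
    (contDiff_const.mul hdiv.sinh).contDiffOn, fun s _ => ?_, fun s _ => ?_⟩
  · rw [deriv_cosh_profile hr₀, deriv_sinh_profile hr₀]
    linear_combination -Real.cosh_sq_sub_sinh_sq (s / r₀)
  · have := Real.cosh_pos (s / r₀)
    positivity

omit a b in
lemma surfaceF_hyperbola (s : ℝ) : r₀ * Real.cosh (s / r₀) =
      r₀ * deriv (fun s => r₀ * Real.sinh (s / r₀)) s ∧
    r₀ * Real.sinh (s / r₀) = r₀ * deriv (fun s => r₀ * Real.cosh (s / r₀)) s := by
  rw [deriv_cosh_profile hr₀, deriv_sinh_profile hr₀]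
  exact ⟨rfl, rfl⟩

/-- On F one has κ = 1/r₀ and μ = -1/r₀, so ‖h‖² = 2/r₀² - 2ω², and only ω has to be computed. -/
lemma sqLength_surfaceF (ha : a ≠ 0) (p : ℝ × ℝ) : sqLength (surfaceF a b r₀) p =
    2 / r₀ ^ 2 * (1 - a ^ 2 * b ^ 2 /
      (a ^ 2 * Real.cosh (p.1 / r₀) ^ 2 + b ^ 2 * Real.sinh (p.1 / r₀) ^ 2) ^ 2) := by
  have h := isProfile_surfaceF a b hr₀ ha
  have hmem := Set.mem_univ p.1
  have hxw (s : ℝ) (_ : s ∈ Set.univ) := surfaceF_hyperbola hr₀ s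
  have hω : torsionCoeff a b (fun s => r₀ * Real.cosh (s / r₀))
      (fun s => r₀ * Real.sinh (s / r₀)) p.1 = a * b / (r₀ *
        (a ^ 2 * Real.cosh (p.1 / r₀) ^ 2 + b ^ 2 * Real.sinh (p.1 / r₀) ^ 2)) := by
    have hc := Real.cosh_pos (p.1 / r₀)
    have hq : a ^ 2 * Real.cosh (p.1 / r₀) ^ 2 + b ^ 2 * Real.sinh (p.1 / r₀) ^ 2 ≠ 0 := by
      positivity
    rw [torsionCoeff, deriv_cosh_profile hr₀, deriv_sinh_profile hr₀,
      div_eq_div_iff (h.pos p.1 hmem).ne' (mul_ne_zero hr₀ hq)]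
    linear_combination a * b * r₀ ^ 2 *
      (a ^ 2 * Real.cosh (p.1 / r₀) ^ 2 + b ^ 2 * Real.sinh (p.1 / r₀) ^ 2) *
      Real.cosh_sq_sub_sinh_sq (p.1 / r₀)
  rw [surfaceF, h.sqLength_eq hmem, h.curvProfile_of_hyperbola hr₀ hxw hmem,
    h.curvOrbit_of_hyperbola hr₀ hxw hmem, hω, div_pow, div_pow, div_pow, mul_pow, mul_pow]
  simp only [div_eq_mul_inv, mul_inv]
  ring

end SurfaceF

end MinkowskiSurface

/-! ### The classification theorem and the Gauss map of F -/

theorem mainTheorem1 (a b : ℝ) (ha : a ≠ 0) (hb : b ≠ 0) :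
    (∀ (I : Set ℝ) (x w : ℝ → ℝ), IsOpen I → I.OrdConnected → I.Nonempty →
      ContDiffOn ℝ (⊤ : ℕ∞) x I → ContDiffOn ℝ (⊤ : ℕ∞) w I →
      (∀ s ∈ I, deriv x s ^ 2 - deriv w s ^ 2 = -1) →
      MinkowskiSurface.IsTimelikeOn (MinkowskiSurface.doubleRotational a b x w)
        (MinkowskiSurface.paramDomain I) →
      (MinkowskiSurface.HasPointwiseOneTypeFirstKind
          (MinkowskiSurface.doubleRotational a b x w) (MinkowskiSurface.paramDomain I) ↔
        MinkowskiSurface.IsOpenPartOfTimelikePlane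
            (MinkowskiSurface.doubleRotational a b x w) (MinkowskiSurface.paramDomain I) ∨
        ∃ r₀ : ℝ, r₀ ≠ 0 ∧
          MinkowskiSurface.IsOpenPart
            (MinkowskiSurface.doubleRotational a b x w) (MinkowskiSurface.paramDomain I)
            (MinkowskiSurface.surfaceF a b r₀) (MinkowskiSurface.paramDomain Set.univ))) ∧
    (∀ r₀ : ℝ, r₀ ≠ 0 →
      (∃ ν, MinkowskiSurface.IsGaussMap (MinkowskiSurface.surfaceF a b r₀)
        (MinkowskiSurface.paramDomain Set.univ) ν) ∧
      (∀ ν, MinkowskiSurface.IsGaussMap (MinkowskiSurface.surfaceF a b r₀)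
          (MinkowskiSurface.paramDomain Set.univ) ν →
        MinkowskiSurface.GaussMapEq (MinkowskiSurface.surfaceF a b r₀)
          (MinkowskiSurface.paramDomain Set.univ) ν
          (MinkowskiSurface.sqLength (MinkowskiSurface.surfaceF a b r₀)) 0) ∧
      ∀ p ∈ MinkowskiSurface.paramDomain Set.univ,
        MinkowskiSurface.sqLength (MinkowskiSurface.surfaceF a b r₀) p =
          2 / r₀ ^ 2 * (1 - a ^ 2 * b ^ 2 /
            (a ^ 2 * Real.cosh (p.1 / r₀) ^ 2 + b ^ 2 * Real.sinh (p.1 / r₀) ^ 2) ^ 2)) := by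
  open MinkowskiSurface in
  refine ⟨fun I x w hIo hIc hne hx hw hu hM => ?_, fun r₀ hr₀ => ?_⟩
  · have h := isProfile_of_isTimelikeOn hIo hx hw hu hM
    refine ⟨h.isOpenPart_of_hasPointwiseOneTypeFirstKind ha hb hIc hne, ?_⟩
    rintro (hplane | ⟨r₀, -, hF⟩)
    · exact h.hasPointwiseOneTypeFirstKind_of_plane hplane
    · exact h.hasPointwiseOneTypeFirstKind_of_surfaceF hIc hF
  · have h := isProfile_surfaceF a b hr₀ ha
    have hxw (s : ℝ) (_ : s ∈ Set.univ) := surfaceF_hyperbola hr₀ s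
    exact ⟨⟨_, h.isGaussMap_adaptedGaussMap⟩,
      fun ν hν => h.gaussMapEq_sqLength (fun s hs => h.deriv_curv_of_hyperbola hr₀ hxw hs)
        (fun s hs => h.torsion_mul_curv_of_hyperbola hr₀ hxw hs)
        (fun s hs => IsProfile.curv_mul_normalCoeff_of_hyperbola hxw hs) hν,
      fun p _ => sqLength_surfaceF a b hr₀ ha p⟩
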